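/- **Setting ($\mathrm{CoLF}^\omega$).** All syntactic categories are indexed by an observation depth; a subscript $(k)$ denotes the depth. At depth $0$ each category has one unobservable expression, and at depth $k+1$ (variables $x$, term constants $c$, type family constants $a$; everything modulo renaming of bound variables) $$\begin{array}{lrcl} \text{canonical terms}& M_{(k+1)},N_{(k+1)} &::=& \lambda x.\,M_{(k+1)} \mid R_{(k+1)}\\ \text{neutral terms}& R_{(k+1)} &::=& x\cdot T_{(k+1)} \mid c\cdot S_{(k+1)}\\ \text{continuing spines}& T_{(k+1)} &::=& () \mid M_{(k+1)};T_{(k+1)}\\ \text{suspended spines}& S_{(k+1)} &::=& () \mid M_{(k)};S_{(k+1)}\\ \text{atomic types}& P_{(k+1)} &::=& a\cdot S_{(k+1)}\\ \text{canonical types}& A_{(k+1)},B_{(k+1)} &::=& P_{(k+1)} \mid \Pi x{:}A_{(k+1)}.\,B_{(k+1)}\\ \text{kinds}& K_{(k+1)} &::=& \mathsf{type}\mid\mathsf{cotype}\mid \Pi x{:}A_{(k+1)}.\,K_{(k+1)}\\ \text{contexts}& \Gamma_{(k+1)} &::=& \cdot\mid\Gamma_{(k+1)},x{:}A_{(k+1)}\\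 \text{signatures}& \Sigma_{(k+1)} &::=& \cdot\mid\Sigma_{(k+1)},a{:}K_{(k+1)}\mid\Sigma_{(k+1)},c{:}A_{(k+1)} \end{array}$$ An expression $E_{(k+1)}$ can be viewed at depth $k$ by forgetting its last observation; the result is written $E_{(k)}$. Equality of expressions of depth $k$ is structural equality (equality up to depth $k$). *Hereditary substitution.* Simple types are $\tau::=*\mid\tau_1\to\tau_2$; the erasure is $(\Pi x{:}A.B)^o=A^o\to B^o$, $P^o=*$. The partial operation $[N_{(k)}/x]^\tau$ on expressions of depth $k$ is trivial at depth $0$; at depth $k+1$ it is (capture-avoidingly) compositional on $\lambda$, on $y\cdot T$ with $y\neq x$ and on continuing spines; $[N_{(k+1)}/x]^\tau(c\cdot S_{(k+1)})=c\cdot[N_{(k)}/x]^\tau S_{(k+1)}$, where $[N_{(k)}/x]^\tau$ acts on the (depth-$k$) entries of a suspended spine of depth $k+1$; and $[N/x]^\tau(x\cdot T)=([N/x]^\tau T)\rhd^\tau N$, where $()\rhd^{*}R=R$ and $(N';T)\rhd^{\tau_2\to\tau_1}\lambda y.M=T\rhd^{\tau_1}[N'/y]^{\tau_2}M$. No other clause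 applies (otherwise the result is undefined). On types, kinds and contexts of depth $k+1$, $[N_{(k)}/x]^\tau$ acts compositionally, with $[N_{(k)}/x]^\tau(a\cdot S_{(k+1)})=a\cdot[N_{(k)}/x]^\tau S_{(k+1)}$. *Type checking.* All judgments hold at depth $0$. At depth $k+1$, relative to $\Sigma=\Sigma_{(k+1)}$ and with all expressions of depth $k+1$ unless marked: - $\cdot$ is a valid signature; $\Sigma,a{:}K$ (resp. $\Sigma,c{:}A$) is valid if $\Sigma$ is and $\cdot\vdash_\Sigma K\Leftarrow\mathsf{kind}$ (resp. $\cdot\vdash_\Sigma A\Leftarrow\mathsf{type/cotype}$). $\cdot$ is a valid context; $\Gamma,x{:}A$ is valid if $\Gamma$ is and $\Gamma\vdash A\Leftarrow\mathsf{type/cotype}$. - $\Gamma\vdash\mathsf{type}\Leftarrow\mathsf{kind}$; $\Gamma\vdash\mathsf{cotype}\Leftarrow\mathsf{kind}$; $\Gamma\vdash\Pi x{:}A.K\Leftarrow\mathsf{kind}$ if $\Gamma\vdash A\Leftarrow\mathsf{type/cotype}$ and $\Gamma,x{:}A\vdash K\Leftarrow\mathsf{kind}$. - $\Gamma\vdash\Pi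 x{:}B.A\Leftarrow\mathsf{type/cotype}$ if $\Gamma\vdash B\Leftarrow\mathsf{type/cotype}$ and $\Gamma,x{:}B\vdash A\Leftarrow\mathsf{type/cotype}$; $\Gamma\vdash P\Leftarrow\mathsf{type/cotype}$ if $\Gamma\vdash P\Rightarrow K$ with $K\in\{\mathsf{type},\mathsf{cotype}\}$; $\Gamma\vdash a\cdot S\Rightarrow K'$ if $a{:}K\in\Sigma$ and $\Gamma\vdash S\rhd K\Rightarrow K'$. - $\Gamma\vdash()\rhd K\Rightarrow K$; $\Gamma\vdash(M_{(k)};S)\rhd\Pi x{:}A.K\Rightarrow K''$ if $\Gamma_{(k)}\vdash_{\Sigma_{(k)}}M_{(k)}\Leftarrow A_{(k)}$, $[M_{(k)}/x]^{A^o}K=K'$ and $\Gamma\vdash S\rhd K'\Rightarrow K''$. - $\Gamma\vdash R\Leftarrow P$ if $\Gamma\vdash R\Rightarrow P'$ and $P'=P$; $\Gamma\vdash\lambda x.M\Leftarrow\Pi x{:}B.A$ if $\Gamma,x{:}B\vdash M\Leftarrow A$. - $\Gamma\vdash x\cdot T\Rightarrow P$ if $x{:}A\in\Gamma$ and $\Gamma\vdash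 T\rhd A\Rightarrow P$; $\Gamma\vdash c\cdot S\Rightarrow P$ if $c{:}A\in\Sigma$ and $\Gamma\vdash S\rhd A\Rightarrow P$. - $\Gamma\vdash()\rhd P\Rightarrow P$ for both kinds of spines; $\Gamma\vdash(M;T)\rhd\Pi x{:}B.A\Rightarrow P$ if $\Gamma\vdash M\Leftarrow B$, $[M_{(k)}/x]^{B^o}A=A'$ and $\Gamma\vdash T\rhd A'\Rightarrow P$; $\Gamma\vdash(M_{(k)};S)\rhd\Pi x{:}B.A\Rightarrow P$ if $\Gamma_{(k)}\vdash_{\Sigma_{(k)}}M_{(k)}\Leftarrow B_{(k)}$, $[M_{(k)}/x]^{B^o}A=A'$ and $\Gamma\vdash S\rhd A'\Rightarrow P$. Every judgment, including each one inside a derivation (so in the rule for $\lambda$ also $\Gamma\vdash B\Leftarrow\mathsf{type/cotype}$), presupposes that its signature and its context are valid. **Theorem (Substitution).** Let $k\ge 0$, let $\Sigma$ be a signature of depth $k+1$, and suppose that $\Gamma_{(k+1)}\vdash_\Sigma N_{(k+1)}\Leftarrow A_{(k+1)}$. Below, $[N/x]$ stands for $[N/x]^{A^o}$. 1. If $\Gamma_{(k+1)},x{:}A_{(k+1)},\Gamma'_{(k+1)}\vdash_\Sigma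 M_{(k+1)}\Leftarrow B_{(k+1)}$, then $[N_{(k)}/x]\Gamma'_{(k+1)}$, $[N_{(k+1)}/x]M_{(k+1)}$ and $[N_{(k)}/x]B_{(k+1)}$ are defined and $$\Gamma_{(k+1)},[N_{(k)}/x]\Gamma'_{(k+1)}\vdash_\Sigma[N_{(k+1)}/x]M_{(k+1)}\Leftarrow[N_{(k)}/x]B_{(k+1)}.$$ 2. If $\Gamma_{(k+1)},x{:}A_{(k+1)},\Gamma'_{(k+1)}\vdash_\Sigma B_{(k+1)}\Leftarrow\mathsf{type/cotype}$, then $[N_{(k)}/x]\Gamma'_{(k+1)}$ and $[N_{(k)}/x]B_{(k+1)}$ are defined and $$\Gamma_{(k+1)},[N_{(k)}/x]\Gamma'_{(k+1)}\vdash_\Sigma[N_{(k)}/x]B_{(k+1)}\Leftarrow\mathsf{type/cotype}.$$ -/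

import Mathlib

/-!
CoLF^ω: typed productive Böhm trees with observation depths, their hereditary substitution, and
the type checking rules.

Every syntactic category is a family indexed by the observation depth `k`; at depth `0` there is a
single, unobservable, expression. Variables are de Bruijn indices (`0` is the innermost binder), so
expressions are taken modulo renaming of bound variables, and equality up to depth `k` of two
expressions of depth `k` is equality in the family at `k`.
-/

namespace CoLF

/-- Names of term constants `c`. -/
abbrev ConName := ℕ

/-- Names of type family constants `a`. -/
abbrev FamName := ℕ

/-- Simple types `τ ::= * | τ₁ → τ₂`. -/
inductive STy : Type where
  | base : STy
  | arrow : STy → STy → STy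

/-! ### Terms -/

mutual

/-- Canonical terms `M₍ₖ₊₁₎ ::= λx. M₍ₖ₊₁₎ | R₍ₖ₊₁₎`. -/
inductive Tm : ℕ → Type where
  | unobs : Tm 0
  | lam {k : ℕ} : Tm (k + 1) → Tm (k + 1)
  | neu {k : ℕ} : Neu (k + 1) → Tm (k + 1)

/-- Neutral terms `R₍ₖ₊₁₎ ::= x · T₍ₖ₊₁₎ | c · S₍ₖ₊₁₎`. -/
inductive Neu : ℕ → Type where
  | unobs : Neu 0
  | var {k : ℕ} : ℕ → CSp (k + 1) → Neu (k + 1)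
  | con {k : ℕ} : ConName → SSp (k + 1) → Neu (k + 1)

/-- Continuing spines `T₍ₖ₊₁₎ ::= () | M₍ₖ₊₁₎ ; T₍ₖ₊₁₎`. -/
inductive CSp : ℕ → Type where
  | unobs : CSp 0
  | nil {k : ℕ} : CSp (k + 1)
  | cons {k : ℕ} : Tm (k + 1) → CSp (k + 1) → CSp (k + 1)

/-- Suspended spines `S₍ₖ₊₁₎ ::= () | M₍ₖ₎ ; S₍ₖ₊₁₎`. -/
inductive SSp : ℕ → Type where
  | unobs : SSp 0
  | nil {k : ℕ} : SSp (k + 1)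
  | cons {k : ℕ} : Tm k → SSp (k + 1) → SSp (k + 1)

end

/-! ### Types, kinds, contexts, signatures -/

/-- Atomic types `P₍ₖ₊₁₎ ::= a · S₍ₖ₊₁₎`. -/
inductive ATy : ℕ → Type where
  | unobs : ATy 0
  | fam {k : ℕ} : FamName → SSp (k + 1) → ATy (k + 1)

/-- Canonical types `A₍ₖ₊₁₎ ::= P₍ₖ₊₁₎ | Πx : A₍ₖ₊₁₎. B₍ₖ₊₁₎`. -/
inductive Ty : ℕ → Type where
  | unobs : Ty 0
  | atom {k : ℕ} : ATy (k + 1) → Ty (k + 1)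
  | pi {k : ℕ} : Ty (k + 1) → Ty (k + 1) → Ty (k + 1)

/-- Kinds `K₍ₖ₊₁₎ ::= type | cotype | Πx : A₍ₖ₊₁₎. K₍ₖ₊₁₎`. -/
inductive Kd : ℕ → Type where
  | unobs : Kd 0
  | type {k : ℕ} : Kd (k + 1)
  | cotype {k : ℕ} : Kd (k + 1)
  | pi {k : ℕ} : Ty (k + 1) → Kd (k + 1) → Kd (k + 1)

/-- Contexts, the most recent declaration first: `Γ, x : A` is `A :: Γ`, and `Γ, x : A, Γ'` is
`Γ' ++ A :: Γ`. Every type is relative to the declarations after it in the list. (At depth `0` only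
the number of declarations is recorded; every judgment at depth `0` holds, so it plays no role.) -/
abbrev Ctx (k : ℕ) : Type := List (Ty k)

/-- A signature declaration, `a : K` or `c : A`. -/
inductive Decl (k : ℕ) : Type where
  | fam : FamName → Kd k → Decl k
  | con : ConName → Ty k → Decl k

/-- Signatures, the most recent declaration first. -/
abbrev Sig (k : ℕ) : Type := List (Decl k)

/-! ### Renaming of variables -/

/-- The extension of a renaming under one binder. -/
def liftRen (ρ : ℕ → ℕ) : ℕ → ℕ
  | 0 => 0
  | n + 1 => ρ n + 1

mutual

/-- Renaming of the free variables. -/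
def Tm.rename : {k : ℕ} → (ℕ → ℕ) → Tm k → Tm k
  | _, _, .unobs => .unobs
  | _, ρ, .lam M => .lam (M.rename (liftRen ρ))
  | _, ρ, .neu R => .neu (R.rename ρ)

/-- Renaming of the free variables. -/
def Neu.rename : {k : ℕ} → (ℕ → ℕ) → Neu k → Neu k
  | _, _, .unobs => .unobs
  | _, ρ, .var x T => .var (ρ x) (T.rename ρ)
  | _, ρ, .con c S => .con c (S.rename ρ)

/-- Renaming of the free variables. -/
def CSp.rename : {k : ℕ} → (ℕ → ℕ) → CSp k → CSp k
  | _, _, .unobs => .unobs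
  | _, _, .nil => .nil
  | _, ρ, .cons M T => .cons (M.rename ρ) (T.rename ρ)

/-- Renaming of the free variables. -/
def SSp.rename : {k : ℕ} → (ℕ → ℕ) → SSp k → SSp k
  | _, _, .unobs => .unobs
  | _, _, .nil => .nil
  | _, ρ, .cons M S => .cons (M.rename ρ) (S.rename ρ)

end

/-- Renaming of the free variables. -/
def ATy.rename : {k : ℕ} → (ℕ → ℕ) → ATy k → ATy k
  | _, _, .unobs => .unobs
  | _, ρ, .fam a S => .fam a (S.rename ρ)

/-- Renaming of the free variables. -/
def Ty.rename : {k : ℕ} → (ℕ → ℕ) → Ty k → Ty k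
  | _, _, .unobs => .unobs
  | _, ρ, .atom P => .atom (P.rename ρ)
  | _, ρ, .pi B A => .pi (B.rename ρ) (A.rename (liftRen ρ))

/-- Weakening of a term by `n` further declarations. -/
def Tm.weaken {k : ℕ} (n : ℕ) (M : Tm k) : Tm k := M.rename (fun i => i + n)

/-- Weakening of a type by one further declaration. -/
def Ty.weaken {k : ℕ} (A : Ty k) : Ty k := A.rename Nat.succ

/-! ### Viewing an expression of depth `k + 1` at depth `k` -/

mutual

/-- Forgetting the last observation (the depth `0` is left alone). -/
def Tm.truncAux : {k : ℕ} → Tm k → Tm (k - 1)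
  | _, .unobs => .unobs
  | _, .lam (k := 0) _ => .unobs
  | _, .lam (k := _ + 1) M => .lam M.truncAux
  | _, .neu (k := 0) _ => .unobs
  | _, .neu (k := _ + 1) R => .neu R.truncAux

/-- Forgetting the last observation (the depth `0` is left alone). -/
def Neu.truncAux : {k : ℕ} → Neu k → Neu (k - 1)
  | _, .unobs => .unobs
  | _, .var (k := 0) _ _ => .unobs
  | _, .var (k := _ + 1) x T => .var x T.truncAux
  | _, .con (k := 0) _ _ => .unobs
  | _, .con (k := _ + 1) c S => .con c S.truncAux

/-- Forgetting the last observation (the depth `0` is left alone). -/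
def CSp.truncAux : {k : ℕ} → CSp k → CSp (k - 1)
  | _, .unobs => .unobs
  | _, .nil (k := 0) => .unobs
  | _, .nil (k := _ + 1) => .nil
  | _, .cons (k := 0) _ _ => .unobs
  | _, .cons (k := _ + 1) M T => .cons M.truncAux T.truncAux

/-- Forgetting the last observation (the depth `0` is left alone). -/
def SSp.truncAux : {k : ℕ} → SSp k → SSp (k - 1)
  | _, .unobs => .unobs
  | _, .nil (k := 0) => .unobs
  | _, .nil (k := _ + 1) => .nil
  | _, .cons (k := 0) _ _ => .unobs
  | _, .cons (k := _ + 1) M S => .cons M.truncAux S.truncAux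

end

/-- Forgetting the last observation (the depth `0` is left alone). -/
def ATy.truncAux : {k : ℕ} → ATy k → ATy (k - 1)
  | _, .unobs => .unobs
  | _, .fam (k := 0) _ _ => .unobs
  | _, .fam (k := _ + 1) a S => .fam a S.truncAux

/-- Forgetting the last observation (the depth `0` is left alone). -/
def Ty.truncAux : {k : ℕ} → Ty k → Ty (k - 1)
  | _, .unobs => .unobs
  | _, .atom (k := 0) _ => .unobs
  | _, .atom (k := _ + 1) P => .atom P.truncAux
  | _, .pi (k := 0) _ _ => .unobs
  | _, .pi (k := _ + 1) B A => .pi B.truncAux A.truncAux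

/-- Forgetting the last observation (the depth `0` is left alone). -/
def Kd.truncAux : {k : ℕ} → Kd k → Kd (k - 1)
  | _, .unobs => .unobs
  | _, .type (k := 0) => .unobs
  | _, .type (k := _ + 1) => .type
  | _, .cotype (k := 0) => .unobs
  | _, .cotype (k := _ + 1) => .cotype
  | _, .pi (k := 0) _ _ => .unobs
  | _, .pi (k := _ + 1) A K => .pi A.truncAux K.truncAux

/-- `M₍ₖ₊₁₎` viewed at depth `k`. -/
def Tm.trunc {k : ℕ} (M : Tm (k + 1)) : Tm k := M.truncAux

/-- `A₍ₖ₊₁₎` viewed at depth `k`. -/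
def Ty.trunc {k : ℕ} (A : Ty (k + 1)) : Ty k := A.truncAux

/-- `K₍ₖ₊₁₎` viewed at depth `k`. -/
def Kd.trunc {k : ℕ} (K : Kd (k + 1)) : Kd k := K.truncAux

/-- A declaration of depth `k + 1` viewed at depth `k`. -/
def Decl.trunc {k : ℕ} : Decl (k + 1) → Decl k
  | .fam a K => .fam a K.trunc
  | .con c A => .con c A.trunc

/-- `Γ₍ₖ₊₁₎` viewed at depth `k`. -/
def Ctx.trunc {k : ℕ} (Γ : Ctx (k + 1)) : Ctx k := Γ.map Ty.trunc

/-- `Σ₍ₖ₊₁₎` viewed at depth `k`. -/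
def Sig.trunc {k : ℕ} (Sg : Sig (k + 1)) : Sig k := Sg.map Decl.trunc

/-! ### Hereditary substitution

Hereditary substitution is a partial operation, given by its graph. The substituted term `N` lives
in the context in which the variable `x` has been deleted, so variables above `x` go down by one,
and `N` is weakened when a binder is crossed. -/

/-- The erasure `A°` of a type to a simple type (only used at positive depth). -/
def Ty.erase : {k : ℕ} → Ty k → STy
  | _, .unobs => .base
  | _, .atom _ => .base
  | _, .pi A₂ A₁ => .arrow A₂.erase A₁.erase

mutual

/-- `[N₍ₖ₎/x]^τ M₍ₖ₎ = M'₍ₖ₎`. -/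
inductive SubTm : {k : ℕ} → Tm k → ℕ → STy → Tm k → Tm k → Prop where
  | zero (N : Tm 0) (x : ℕ) (τ : STy) (M M' : Tm 0) : SubTm N x τ M M'
  | neu {k : ℕ} {N : Tm (k + 1)} {x : ℕ} {τ : STy} {R R' : Neu (k + 1)} :
      SubNe N x τ R R' → SubTm N x τ (.neu R) (.neu R')
  | lam {k : ℕ} {N : Tm (k + 1)} {x : ℕ} {τ : STy} {M M' : Tm (k + 1)} :
      SubTm (N.weaken 1) (x + 1) τ M M' → SubTm N x τ (.lam M) (.lam M')

/-- `[N₍ₖ₎/x]^τ R₍ₖ₎ = R'₍ₖ₎`. -/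
inductive SubNe : {k : ℕ} → Tm k → ℕ → STy → Neu k → Neu k → Prop where
  | zero (N : Tm 0) (x : ℕ) (τ : STy) (R R' : Neu 0) : SubNe N x τ R R'
  | var_eq {k : ℕ} {N : Tm (k + 1)} {x : ℕ} {τ : STy} {T T' : CSp (k + 1)} {R' : Neu (k + 1)} :
      SubCSp N x τ T T' → AppCSp T' τ N R' → SubNe N x τ (.var x T) R'
  | var_lt {k : ℕ} {N : Tm (k + 1)} {x : ℕ} {τ : STy} {y : ℕ} {T T' : CSp (k + 1)} :
      y < x → SubCSp N x τ T T' → SubNe N x τ (.var y T) (.var y T')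
  | var_gt {k : ℕ} {N : Tm (k + 1)} {x : ℕ} {τ : STy} {y : ℕ} {T T' : CSp (k + 1)} :
      x ≤ y → SubCSp N x τ T T' → SubNe N x τ (.var (y + 1) T) (.var y T')
  | con {k : ℕ} {N : Tm (k + 1)} {x : ℕ} {τ : STy} {c : ConName} {S S' : SSp (k + 1)} :
      SubSSp N.trunc x τ S S' → SubNe N x τ (.con c S) (.con c S')

/-- `[N₍ₖ₎/x]^τ T₍ₖ₎ = T'₍ₖ₎`. -/
inductive SubCSp : {k : ℕ} → Tm k → ℕ → STy → CSp k → CSp k → Prop where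
  | zero (N : Tm 0) (x : ℕ) (τ : STy) (T T' : CSp 0) : SubCSp N x τ T T'
  | nil {k : ℕ} {N : Tm (k + 1)} {x : ℕ} {τ : STy} : SubCSp N x τ .nil .nil
  | cons {k : ℕ} {N : Tm (k + 1)} {x : ℕ} {τ : STy} {M M' : Tm (k + 1)} {T T' : CSp (k + 1)} :
      SubTm N x τ M M' → SubCSp N x τ T T' → SubCSp N x τ (.cons M T) (.cons M' T')

/-- Spine application `T₍ₖ₎ ▷^τ N₍ₖ₎ = R'₍ₖ₎`. -/
inductive AppCSp : {k : ℕ} → CSp k → STy → Tm k → Neu k → Prop where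
  | zero (T : CSp 0) (τ : STy) (N : Tm 0) (R' : Neu 0) : AppCSp T τ N R'
  | nil {k : ℕ} {R : Neu (k + 1)} : AppCSp .nil .base (.neu R) R
  | cons {k : ℕ} {N : Tm (k + 1)} {T : CSp (k + 1)} {τ₂ τ₁ : STy} {M M' : Tm (k + 1)}
      {R' : Neu (k + 1)} :
      SubTm N 0 τ₂ M M' → AppCSp T τ₁ M' R' → AppCSp (.cons N T) (.arrow τ₂ τ₁) (.lam M) R'

/-- `[N₍ₖ₎/x]^τ S₍ₖ₊₁₎ = S'₍ₖ₊₁₎`. -/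
inductive SubSSp : {k : ℕ} → Tm k → ℕ → STy → SSp (k + 1) → SSp (k + 1) → Prop where
  | nil {k : ℕ} {N : Tm k} {x : ℕ} {τ : STy} : SubSSp N x τ .nil .nil
  | cons {k : ℕ} {N : Tm k} {x : ℕ} {τ : STy} {M M' : Tm k} {S S' : SSp (k + 1)} :
      SubTm N x τ M M' → SubSSp N x τ S S' → SubSSp N x τ (.cons M S) (.cons M' S')

end

/-- `[N₍ₖ₎/x]^τ P₍ₖ₊₁₎ = P'₍ₖ₊₁₎`. -/
inductive SubATy : {k : ℕ} → Tm k → ℕ → STy → ATy (k + 1) → ATy (k + 1) → Prop where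
  | fam {k : ℕ} {N : Tm k} {x : ℕ} {τ : STy} {a : FamName} {S S' : SSp (k + 1)} :
      SubSSp N x τ S S' → SubATy N x τ (.fam a S) (.fam a S')

/-- `[N₍ₖ₎/x]^τ A₍ₖ₊₁₎ = A'₍ₖ₊₁₎`. -/
inductive SubTy : {k : ℕ} → Tm k → ℕ → STy → Ty (k + 1) → Ty (k + 1) → Prop where
  | atom {k : ℕ} {N : Tm k} {x : ℕ} {τ : STy} {P P' : ATy (k + 1)} :
      SubATy N x τ P P' → SubTy N x τ (.atom P) (.atom P')
  | pi {k : ℕ} {N : Tm k} {x : ℕ} {τ : STy} {B B' A A' : Ty (k + 1)} :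
      SubTy N x τ B B' → SubTy (N.weaken 1) (x + 1) τ A A' →
      SubTy N x τ (.pi B A) (.pi B' A')

/-- `[N₍ₖ₎/x]^τ K₍ₖ₊₁₎ = K'₍ₖ₊₁₎`. -/
inductive SubKd : {k : ℕ} → Tm k → ℕ → STy → Kd (k + 1) → Kd (k + 1) → Prop where
  | type {k : ℕ} {N : Tm k} {x : ℕ} {τ : STy} : SubKd N x τ .type .type
  | cotype {k : ℕ} {N : Tm k} {x : ℕ} {τ : STy} : SubKd N x τ .cotype .cotype
  | pi {k : ℕ} {N : Tm k} {x : ℕ} {τ : STy} {A A' : Ty (k + 1)} {K K' : Kd (k + 1)} :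
      SubTy N x τ A A' → SubKd (N.weaken 1) (x + 1) τ K K' →
      SubKd N x τ (.pi A K) (.pi A' K')

/-- `[N₍ₖ₎/x]^τ Γ'₍ₖ₊₁₎ = Γ''₍ₖ₊₁₎`, where `x` is the variable declared immediately before `Γ'` and
`N` lives in the context before `x`. -/
inductive SubCtx {k : ℕ} (N : Tm k) (τ : STy) : Ctx (k + 1) → Ctx (k + 1) → Prop where
  | nil : SubCtx N τ [] []
  | cons {Γ Γ' : Ctx (k + 1)} {A A' : Ty (k + 1)} :
      SubCtx N τ Γ Γ' → SubTy (N.weaken Γ.length) Γ.length τ A A' →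
      SubCtx N τ (A :: Γ) (A' :: Γ')

/-! ### Type checking -/

/-- `x : A ∈ Γ`, with `A` weakened so as to be relative to the whole of `Γ`. -/
inductive Lookup {k : ℕ} : Ctx k → ℕ → Ty k → Prop where
  | here {Γ : Ctx k} {A : Ty k} : Lookup (A :: Γ) 0 A.weaken
  | there {Γ : Ctx k} {A B : Ty k} {x : ℕ} : Lookup Γ x A → Lookup (B :: Γ) (x + 1) A.weaken

mutual

/-- `Γ ⊢ A ⇐ type/cotype`. -/
inductive TyOk : {k : ℕ} → Sig k → Ctx k → Ty k → Prop where
  | zero (Sg : Sig 0) (Γ : Ctx 0) (A : Ty 0) : TyOk Sg Γ A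
  | pi {k : ℕ} {Sg : Sig (k + 1)} {Γ : Ctx (k + 1)} {B A : Ty (k + 1)} :
      TyOk Sg Γ B → TyOk Sg (B :: Γ) A → TyOk Sg Γ (.pi B A)
  | atom {k : ℕ} {Sg : Sig (k + 1)} {Γ : Ctx (k + 1)} {P : ATy (k + 1)} {K : Kd (k + 1)} :
      SynATy Sg Γ P K → K = .type ∨ K = .cotype → TyOk Sg Γ (.atom P)

/-- `Γ ⊢ P ⇒ K`. -/
inductive SynATy : {k : ℕ} → Sig k → Ctx k → ATy k → Kd k → Prop where
  | zero (Sg : Sig 0) (Γ : Ctx 0) (P : ATy 0) (K : Kd 0) : SynATy Sg Γ P K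
  | fam {k : ℕ} {Sg : Sig (k + 1)} {Γ : Ctx (k + 1)} {a : FamName} {S : SSp (k + 1)}
      {K K' : Kd (k + 1)} :
      Decl.fam a K ∈ Sg → SpKd Sg Γ S K K' → SynATy Sg Γ (.fam a S) K'

/-- `Γ ⊢ S ▷ K ⇒ K'`. The arguments in a suspended spine of depth `k + 1` are of depth `k`, and
they are checked at depth `k`. -/
inductive SpKd : {k : ℕ} → Sig k → Ctx k → SSp k → Kd k → Kd k → Prop where
  | zero (Sg : Sig 0) (Γ : Ctx 0) (S : SSp 0) (K K' : Kd 0) : SpKd Sg Γ S K K'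
  | nil {k : ℕ} {Sg : Sig (k + 1)} {Γ : Ctx (k + 1)} {K : Kd (k + 1)} : SpKd Sg Γ .nil K K
  | cons {k : ℕ} {Sg : Sig (k + 1)} {Γ : Ctx (k + 1)} {M : Tm k} {S : SSp (k + 1)}
      {A : Ty (k + 1)} {K K' K'' : Kd (k + 1)} :
      Chk Sg.trunc Γ.trunc M A.trunc → SubKd M 0 A.erase K K' → SpKd Sg Γ S K' K'' →
      SpKd Sg Γ (.cons M S) (.pi A K) K''

/-- `Γ ⊢ M ⇐ A`. In the rule for `λ` the premise `TyOk Sg Γ B` is what the other premise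
presupposes, namely that its context `Γ, x : B` is well-formed when `Γ` is. -/
inductive Chk : {k : ℕ} → Sig k → Ctx k → Tm k → Ty k → Prop where
  | zero (Sg : Sig 0) (Γ : Ctx 0) (M : Tm 0) (A : Ty 0) : Chk Sg Γ M A
  | neu {k : ℕ} {Sg : Sig (k + 1)} {Γ : Ctx (k + 1)} {R : Neu (k + 1)} {P P' : ATy (k + 1)} :
      SynNe Sg Γ R P' → P' = P → Chk Sg Γ (.neu R) (.atom P)
  | lam {k : ℕ} {Sg : Sig (k + 1)} {Γ : Ctx (k + 1)} {M : Tm (k + 1)} {B A : Ty (k + 1)} :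
      TyOk Sg Γ B → Chk Sg (B :: Γ) M A → Chk Sg Γ (.lam M) (.pi B A)

/-- `Γ ⊢ R ⇒ P`. -/
inductive SynNe : {k : ℕ} → Sig k → Ctx k → Neu k → ATy k → Prop where
  | zero (Sg : Sig 0) (Γ : Ctx 0) (R : Neu 0) (P : ATy 0) : SynNe Sg Γ R P
  | var {k : ℕ} {Sg : Sig (k + 1)} {Γ : Ctx (k + 1)} {x : ℕ} {A : Ty (k + 1)} {T : CSp (k + 1)}
      {P : ATy (k + 1)} :
      Lookup Γ x A → CSpTy Sg Γ T A P → SynNe Sg Γ (.var x T) P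
  | con {k : ℕ} {Sg : Sig (k + 1)} {Γ : Ctx (k + 1)} {c : ConName} {A : Ty (k + 1)}
      {S : SSp (k + 1)} {P : ATy (k + 1)} :
      Decl.con c A ∈ Sg → SSpTy Sg Γ S A P → SynNe Sg Γ (.con c S) P

/-- `Γ ⊢ T ▷ A ⇒ P`. -/
inductive CSpTy : {k : ℕ} → Sig k → Ctx k → CSp k → Ty k → ATy k → Prop where
  | zero (Sg : Sig 0) (Γ : Ctx 0) (T : CSp 0) (A : Ty 0) (P : ATy 0) : CSpTy Sg Γ T A P
  | nil {k : ℕ} {Sg : Sig (k + 1)} {Γ : Ctx (k + 1)} {P : ATy (k + 1)} :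
      CSpTy Sg Γ .nil (.atom P) P
  | cons {k : ℕ} {Sg : Sig (k + 1)} {Γ : Ctx (k + 1)} {M : Tm (k + 1)} {T : CSp (k + 1)}
      {B A A' : Ty (k + 1)} {P : ATy (k + 1)} :
      Chk Sg Γ M B → SubTy M.trunc 0 B.erase A A' → CSpTy Sg Γ T A' P →
      CSpTy Sg Γ (.cons M T) (.pi B A) P

/-- `Γ ⊢ S ▷ A ⇒ P`. The arguments in a suspended spine of depth `k + 1` are of depth `k`, and
they are checked at depth `k`. -/
inductive SSpTy : {k : ℕ} → Sig k → Ctx k → SSp k → Ty k → ATy k → Prop where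
  | zero (Sg : Sig 0) (Γ : Ctx 0) (S : SSp 0) (A : Ty 0) (P : ATy 0) : SSpTy Sg Γ S A P
  | nil {k : ℕ} {Sg : Sig (k + 1)} {Γ : Ctx (k + 1)} {P : ATy (k + 1)} :
      SSpTy Sg Γ .nil (.atom P) P
  | cons {k : ℕ} {Sg : Sig (k + 1)} {Γ : Ctx (k + 1)} {M : Tm k} {S : SSp (k + 1)}
      {B A A' : Ty (k + 1)} {P : ATy (k + 1)} :
      Chk Sg.trunc Γ.trunc M B.trunc → SubTy M 0 B.erase A A' → SSpTy Sg Γ S A' P →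
      SSpTy Sg Γ (.cons M S) (.pi B A) P

end

/-- `Γ ⊢ K ⇐ kind`. -/
inductive KdOk : {k : ℕ} → Sig k → Ctx k → Kd k → Prop where
  | zero (Sg : Sig 0) (Γ : Ctx 0) (K : Kd 0) : KdOk Sg Γ K
  | type {k : ℕ} {Sg : Sig (k + 1)} {Γ : Ctx (k + 1)} : KdOk Sg Γ .type
  | cotype {k : ℕ} {Sg : Sig (k + 1)} {Γ : Ctx (k + 1)} : KdOk Sg Γ .cotype
  | pi {k : ℕ} {Sg : Sig (k + 1)} {Γ : Ctx (k + 1)} {A : Ty (k + 1)} {K : Kd (k + 1)} :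
      TyOk Sg Γ A → KdOk Sg (A :: Γ) K → KdOk Sg Γ (.pi A K)

/-- `⊢ Σ sig`. -/
inductive SigOk : {k : ℕ} → Sig k → Prop where
  | zero (Sg : Sig 0) : SigOk Sg
  | nil {k : ℕ} : SigOk ([] : Sig (k + 1))
  | fam {k : ℕ} {Sg : Sig (k + 1)} {a : FamName} {K : Kd (k + 1)} :
      SigOk Sg → KdOk Sg [] K → SigOk (Decl.fam a K :: Sg)
  | con {k : ℕ} {Sg : Sig (k + 1)} {c : ConName} {A : Ty (k + 1)} :
      SigOk Sg → TyOk Sg [] A → SigOk (Decl.con c A :: Sg)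

/-- `⊢ Γ ctx`. -/
inductive CtxOk : {k : ℕ} → Sig k → Ctx k → Prop where
  | zero (Sg : Sig 0) (Γ : Ctx 0) : CtxOk Sg Γ
  | nil {k : ℕ} {Sg : Sig (k + 1)} : CtxOk Sg []
  | cons {k : ℕ} {Sg : Sig (k + 1)} {Γ : Ctx (k + 1)} {A : Ty (k + 1)} :
      CtxOk Sg Γ → TyOk Sg Γ A → CtxOk Sg (A :: Γ)

/-- The judgment `Γ ⊢ M ⇐ A` together with its presuppositions: the signature is valid and the
context is well-formed. -/
structure HasType {k : ℕ} (Sg : Sig k) (Γ : Ctx k) (M : Tm k) (A : Ty k) : Prop where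
  sig : SigOk Sg
  ctx : CtxOk Sg Γ
  chk : Chk Sg Γ M A

/-- The judgment `Γ ⊢ A ⇐ type/cotype` together with its presuppositions. -/
structure IsType {k : ℕ} (Sg : Sig k) (Γ : Ctx k) (A : Ty k) : Prop where
  sig : SigOk Sg
  ctx : CtxOk Sg Γ
  ok : TyOk Sg Γ A

end CoLF

namespace CoLF

/-- The renaming that makes room for a new variable `x`. -/
def insRen (x i : ℕ) : ℕ := if i < x then i else i + 1

theorem liftRen_insRen (x : ℕ) : liftRen (insRen x) = insRen (x + 1) := by
  funext i
  cases i with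
  | zero => simp [liftRen, insRen]
  | succ i => simp only [liftRen, insRen]; split_ifs <;> omega

theorem insRen_zero : insRen 0 = Nat.succ := by
  funext i; simp [insRen]

theorem liftRen_comp (ρ ρ' : ℕ → ℕ) : liftRen ρ ∘ liftRen ρ' = liftRen (ρ ∘ ρ') := by
  funext i; cases i <;> rfl

theorem eq_or_eq_insRen (x y : ℕ) : y = x ∨ ∃ z, y = insRen x z := by
  rcases lt_trichotomy y x with h | h | h
  · exact Or.inr ⟨y, by simp [insRen, h]⟩
  · exact Or.inl h
  · refine Or.inr ⟨y - 1, ?_⟩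
    simp only [insRen]; split_ifs <;> omega

theorem insRen_ne (x z : ℕ) : insRen x z ≠ x := by
  simp only [insRen]; split_ifs <;> omega

theorem insRen_insRen {x y : ℕ} (h : x ≤ y) (i : ℕ) :
    insRen x (insRen y i) = insRen (y + 1) (insRen x i) := by
  simp only [insRen]; split_ifs <;> omega

mutual

theorem Tm.rename_rename : {k : ℕ} → (M : Tm k) → (ρ ρ' : ℕ → ℕ) →
    (M.rename ρ').rename ρ = M.rename (ρ ∘ ρ')
  | _, .unobs, _, _ => by simp [Tm.rename]
  | _, .lam M, ρ, ρ' => by simp [Tm.rename, M.rename_rename, liftRen_comp]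
  | _, .neu R, ρ, ρ' => by simp [Tm.rename, R.rename_rename]

theorem Neu.rename_rename : {k : ℕ} → (R : Neu k) → (ρ ρ' : ℕ → ℕ) →
    (R.rename ρ').rename ρ = R.rename (ρ ∘ ρ')
  | _, .unobs, _, _ => by simp [Neu.rename]
  | _, .var x T, ρ, ρ' => by simp [Neu.rename, T.rename_rename]
  | _, .con c S, ρ, ρ' => by simp [Neu.rename, S.rename_rename]

theorem CSp.rename_rename : {k : ℕ} → (T : CSp k) → (ρ ρ' : ℕ → ℕ) →
    (T.rename ρ').rename ρ = T.rename (ρ ∘ ρ')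
  | _, .unobs, _, _ => by simp [CSp.rename]
  | _, .nil, _, _ => by simp [CSp.rename]
  | _, .cons M T, ρ, ρ' => by simp [CSp.rename, M.rename_rename, T.rename_rename]

theorem SSp.rename_rename : {k : ℕ} → (S : SSp k) → (ρ ρ' : ℕ → ℕ) →
    (S.rename ρ').rename ρ = S.rename (ρ ∘ ρ')
  | _, .unobs, _, _ => by simp [SSp.rename]
  | _, .nil, _, _ => by simp [SSp.rename]
  | _, .cons M S, ρ, ρ' => by simp [SSp.rename, M.rename_rename, S.rename_rename]

end

mutual

theorem Tm.truncAux_rename : {k : ℕ} → (M : Tm k) → (ρ : ℕ → ℕ) →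
    (M.rename ρ).truncAux = M.truncAux.rename ρ
  | _, .unobs, _ => by simp [Tm.rename, Tm.truncAux]
  | _, .lam (k := 0) M, ρ => by simp [Tm.rename, Tm.truncAux]
  | _, .lam (k := _ + 1) M, ρ => by simp [Tm.rename, Tm.truncAux, M.truncAux_rename]
  | _, .neu (k := 0) R, ρ => by simp [Tm.rename, Tm.truncAux]
  | _, .neu (k := _ + 1) R, ρ => by simp [Tm.rename, Tm.truncAux, R.truncAux_rename]

theorem Neu.truncAux_rename : {k : ℕ} → (R : Neu k) → (ρ : ℕ → ℕ) →
    (R.rename ρ).truncAux = R.truncAux.rename ρ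
  | _, .unobs, _ => by simp [Neu.rename, Neu.truncAux]
  | _, .var (k := 0) x T, ρ => by simp [Neu.rename, Neu.truncAux]
  | _, .var (k := _ + 1) x T, ρ => by simp [Neu.rename, Neu.truncAux, T.truncAux_rename]
  | _, .con (k := 0) c S, ρ => by simp [Neu.rename, Neu.truncAux]
  | _, .con (k := _ + 1) c S, ρ => by simp [Neu.rename, Neu.truncAux, S.truncAux_rename]

theorem CSp.truncAux_rename : {k : ℕ} → (T : CSp k) → (ρ : ℕ → ℕ) →
    (T.rename ρ).truncAux = T.truncAux.rename ρ
  | _, .unobs, _ => by simp [CSp.rename, CSp.truncAux]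
  | _, .nil (k := 0), _ => by simp [CSp.rename, CSp.truncAux]
  | _, .nil (k := _ + 1), _ => by simp [CSp.rename, CSp.truncAux]
  | _, .cons (k := 0) M T, ρ => by simp [CSp.rename, CSp.truncAux]
  | _, .cons (k := _ + 1) M T, ρ => by
    simp [CSp.rename, CSp.truncAux, M.truncAux_rename, T.truncAux_rename]

theorem SSp.truncAux_rename : {k : ℕ} → (S : SSp k) → (ρ : ℕ → ℕ) →
    (S.rename ρ).truncAux = S.truncAux.rename ρ
  | _, .unobs, _ => by simp [SSp.rename, SSp.truncAux]
  | _, .nil (k := 0), _ => by simp [SSp.rename, SSp.truncAux]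
  | _, .nil (k := _ + 1), _ => by simp [SSp.rename, SSp.truncAux]
  | _, .cons (k := 0) M S, ρ => by simp [SSp.rename, SSp.truncAux]
  | _, .cons (k := _ + 1) M S, ρ => by
    simp [SSp.rename, SSp.truncAux, M.truncAux_rename, S.truncAux_rename]

end

theorem Tm.trunc_rename {k : ℕ} (M : Tm (k + 1)) (ρ : ℕ → ℕ) :
    (M.rename ρ).trunc = M.trunc.rename ρ := M.truncAux_rename ρ

theorem Tm.trunc_weaken {k : ℕ} (M : Tm (k + 1)) (n : ℕ) :
    (M.weaken n).trunc = M.trunc.weaken n := M.truncAux_rename _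

theorem Tm.weaken_one {k : ℕ} (M : Tm k) : M.weaken 1 = M.rename (insRen 0) := by
  rw [insRen_zero]; rfl

theorem Tm.rename_weaken_one {k : ℕ} (M : Tm k) (ρ : ℕ → ℕ) :
    (M.rename ρ).weaken 1 = (M.weaken 1).rename (liftRen ρ) := by
  simp only [Tm.weaken, Tm.rename_rename]; rfl

instance : Subsingleton (Tm 0) := ⟨fun a b => by cases a; cases b; rfl⟩
instance : Subsingleton (Neu 0) := ⟨fun a b => by cases a; cases b; rfl⟩
instance : Subsingleton (CSp 0) := ⟨fun a b => by cases a; cases b; rfl⟩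
instance : Subsingleton (Ty 0) := ⟨fun a b => by cases a; cases b; rfl⟩

/-! ### Basic properties of hereditary substitution -/

theorem SubNe.var_ins {k : ℕ} {N : Tm (k + 1)} {x : ℕ} {τ : STy} {T T' : CSp (k + 1)} (z : ℕ)
    (h : SubCSp N x τ T T') : SubNe N x τ (.var (insRen x z) T) (.var z T') := by
  by_cases hz : z < x
  · simp only [insRen, hz, if_true]; exact .var_lt hz h
  · simp only [insRen, hz, if_false]; exact .var_gt (not_lt.1 hz) h

theorem SubNe.inv_var {k : ℕ} {N : Tm (k + 1)} {x : ℕ} {τ : STy} {T : CSp (k + 1)}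
    {R : Neu (k + 1)} (h : SubNe N x τ (.var x T) R) :
    ∃ T', SubCSp N x τ T T' ∧ AppCSp T' τ N R := by
  cases h with
  | var_eq h₁ h₂ => exact ⟨_, h₁, h₂⟩
  | var_lt h => omega
  | var_gt h => omega

theorem SubNe.inv_var_ins {k : ℕ} {N : Tm (k + 1)} {x z : ℕ} {τ : STy} {T : CSp (k + 1)}
    {R : Neu (k + 1)} (h : SubNe N x τ (.var (insRen x z) T) R) :
    ∃ T', SubCSp N x τ T T' ∧ R = .var z T' := by
  generalize hy : insRen x z = y at h
  cases h with
  | var_eq h₁ h₂ => exact absurd hy (insRen_ne _ _)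
  | var_lt h h₁ =>
    refine ⟨_, h₁, ?_⟩
    simp only [insRen] at hy; split_ifs at hy <;> first | omega | rw [hy]
  | var_gt h h₁ =>
    refine ⟨_, h₁, ?_⟩
    simp only [insRen] at hy; split_ifs at hy <;> first | omega | rw [Nat.succ_injective hy]

mutual

theorem SubTm.det : {k : ℕ} → {N : Tm k} → {x : ℕ} → {τ : STy} → {M M₁ M₂ : Tm k} →
    (h : SubTm N x τ M M₁) → SubTm N x τ M M₂ → M₁ = M₂
  | _, _, _, _, _, _, _, .zero .., _ => Subsingleton.elim _ _
  | _, _, _, _, _, _, _, .neu h, .neu h' => by rw [h.det h']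
  | _, _, _, _, _, _, _, .lam h, .lam h' => by rw [h.det h']
termination_by structural _ _ _ _ _ _ _ h => h

theorem SubNe.det : {k : ℕ} → {N : Tm k} → {x : ℕ} → {τ : STy} → {M M₁ M₂ : Neu k} →
    (h : SubNe N x τ M M₁) → SubNe N x τ M M₂ → M₁ = M₂
  | _, _, _, _, _, _, _, .zero .., _ => Subsingleton.elim _ _
  | _, _, _, _, _, _, _, .var_eq h h₁, h' => by
    obtain ⟨T', h₂, h₃⟩ := h'.inv_var
    cases h.det h₂
    exact h₁.det h₃
  | _, _, _, _, _, _, _, .var_lt hy h, h' => by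
    cases h' with
    | var_eq => omega
    | var_lt _ h' => rw [h.det h']
    | var_gt => omega
  | _, _, _, _, _, _, _, .var_gt hy h, h' => by
    cases h' with
    | var_eq => omega
    | var_lt => omega
    | var_gt _ h' => rw [h.det h']
  | _, _, _, _, _, _, _, .con h, .con h' => by rw [h.det h']
termination_by structural _ _ _ _ _ _ _ h => h

theorem SubCSp.det : {k : ℕ} → {N : Tm k} → {x : ℕ} → {τ : STy} → {M M₁ M₂ : CSp k} →
    (h : SubCSp N x τ M M₁) → SubCSp N x τ M M₂ → M₁ = M₂
  | _, _, _, _, _, _, _, .zero .., _ => Subsingleton.elim _ _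
  | _, _, _, _, _, _, _, .nil, .nil => rfl
  | _, _, _, _, _, _, _, .cons h h₁, .cons h' h₁' => by rw [h.det h', h₁.det h₁']
termination_by structural _ _ _ _ _ _ _ h => h

theorem AppCSp.det : {k : ℕ} → {T : CSp k} → {τ : STy} → {N : Tm k} → {R₁ R₂ : Neu k} →
    (h : AppCSp T τ N R₁) → AppCSp T τ N R₂ → R₁ = R₂
  | _, _, _, _, _, _, .zero .., _ => Subsingleton.elim _ _
  | _, _, _, _, _, _, .nil, .nil => rfl
  | _, _, _, _, _, _, .cons h h₁, h' => by
    cases h' with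
    | cons h' h₁' =>
      cases h.det h'
      exact h₁.det h₁'
termination_by structural _ _ _ _ _ _ h => h

theorem SubSSp.det : {k : ℕ} → {N : Tm k} → {x : ℕ} → {τ : STy} → {M M₁ M₂ : SSp (k + 1)} →
    (h : SubSSp N x τ M M₁) → SubSSp N x τ M M₂ → M₁ = M₂
  | _, _, _, _, _, _, _, .nil, .nil => rfl
  | _, _, _, _, _, _, _, .cons h h₁, .cons h' h₁' => by rw [h.det h', h₁.det h₁']
termination_by structural _ _ _ _ _ _ _ h => h

end

/-- `ρ` and `ρ'` are compatible renamings of a context without and with the variable `x`, and `ρ'`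
takes `x` to `x'`. -/
structure RenCompat (ρ' ρ : ℕ → ℕ) (x x' : ℕ) : Prop where
  self : ρ' x = x'
  ins : ∀ i, ρ' (insRen x i) = insRen x' (ρ i)

theorem RenCompat.lift {ρ' ρ : ℕ → ℕ} {x x' : ℕ} (h : RenCompat ρ' ρ x x') :
    RenCompat (liftRen ρ') (liftRen ρ) (x + 1) (x' + 1) where
  self := by simp [liftRen, h.self]
  ins := by
    intro i
    rw [← liftRen_insRen, ← liftRen_insRen]
    cases i <;> simp [liftRen, h.ins]

theorem RenCompat.zero (ρ : ℕ → ℕ) : RenCompat (liftRen ρ) ρ 0 0 where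
  self := rfl
  ins := by intro i; simp [insRen_zero, liftRen]

theorem RenCompat.insert {x n : ℕ} (h : n ≤ x) : RenCompat (insRen n) (insRen n) x (x + 1) where
  self := by simp only [insRen]; split_ifs <;> omega
  ins := fun i => insRen_insRen h i

mutual

theorem SubTm.rename : {k : ℕ} → {N : Tm k} → {x : ℕ} → {τ : STy} → {M M' : Tm k} →
    (h : SubTm N x τ M M') → {ρ' ρ : ℕ → ℕ} → {x' : ℕ} → RenCompat ρ' ρ x x' →
    SubTm (N.rename ρ) x' τ (M.rename ρ') (M'.rename ρ)
  | _, _, _, _, _, _, .zero .., _, _, _, _ => .zero ..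
  | _, _, _, _, _, _, .neu h, _, _, _, c => by
    simp only [Tm.rename]; exact .neu (h.rename c)
  | _, _, _, _, _, _, .lam h, _, _, _, c => by
    have h' := h.rename c.lift
    simp only [Tm.rename]
    rw [← Tm.rename_weaken_one] at h'
    exact .lam h'
termination_by structural _ _ _ _ _ _ h => h

theorem SubNe.rename : {k : ℕ} → {N : Tm k} → {x : ℕ} → {τ : STy} → {M M' : Neu k} →
    (h : SubNe N x τ M M') → {ρ' ρ : ℕ → ℕ} → {x' : ℕ} → RenCompat ρ' ρ x x' →
    SubNe (N.rename ρ) x' τ (M.rename ρ') (M'.rename ρ)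
  | _, _, _, _, _, _, .zero .., _, _, _, _ => .zero ..
  | _, _, _, _, _, _, .var_eq h h₁, _, _, _, c => by
    simp only [Neu.rename, c.self]
    exact .var_eq (h.rename c) (h₁.rename _)
  | _, _, x, _, _, _, .var_lt (y := y) hy h, ρ', ρ, _, c => by
    have e := c.ins y
    simp only [insRen, hy, if_true] at e
    simp only [Neu.rename, e]
    exact .var_ins _ (h.rename c)
  | _, _, x, _, _, _, .var_gt (y := y) hy h, ρ', ρ, _, c => by
    have e := c.ins y
    simp only [insRen, not_lt.2 hy, if_false] at e
    simp only [Neu.rename, e]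
    exact .var_ins _ (h.rename c)
  | _, _, _, _, _, _, .con h, _, _, _, c => by
    have h' := h.rename c
    rw [← Tm.trunc_rename] at h'
    simp only [Neu.rename]
    exact .con h'
termination_by structural _ _ _ _ _ _ h => h

theorem SubCSp.rename : {k : ℕ} → {N : Tm k} → {x : ℕ} → {τ : STy} → {M M' : CSp k} →
    (h : SubCSp N x τ M M') → {ρ' ρ : ℕ → ℕ} → {x' : ℕ} → RenCompat ρ' ρ x x' →
    SubCSp (N.rename ρ) x' τ (M.rename ρ') (M'.rename ρ)
  | _, _, _, _, _, _, .zero .., _, _, _, _ => .zero ..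
  | _, _, _, _, _, _, .nil, _, _, _, _ => by simp only [CSp.rename]; exact .nil
  | _, _, _, _, _, _, .cons h h₁, _, _, _, c => by
    simp only [CSp.rename]; exact .cons (h.rename c) (h₁.rename c)
termination_by structural _ _ _ _ _ _ h => h

theorem AppCSp.rename : {k : ℕ} → {T : CSp k} → {τ : STy} → {N : Tm k} → {R : Neu k} →
    (h : AppCSp T τ N R) → (ρ : ℕ → ℕ) → AppCSp (T.rename ρ) τ (N.rename ρ) (R.rename ρ)
  | _, _, _, _, _, .zero .., _ => .zero ..
  | _, _, _, _, _, .nil, _ => by simp only [CSp.rename, Tm.rename]; exact .nil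
  | _, _, _, _, _, .cons h h₁, ρ => by
    simp only [CSp.rename, Tm.rename]
    exact .cons (h.rename (.zero ρ)) (h₁.rename ρ)
termination_by structural _ _ _ _ _ h => h

theorem SubSSp.rename : {k : ℕ} → {N : Tm k} → {x : ℕ} → {τ : STy} → {M M' : SSp (k + 1)} →
    (h : SubSSp N x τ M M') → {ρ' ρ : ℕ → ℕ} → {x' : ℕ} → RenCompat ρ' ρ x x' →
    SubSSp (N.rename ρ) x' τ (M.rename ρ') (M'.rename ρ)
  | _, _, _, _, _, _, .nil, _, _, _, _ => by simp only [SSp.rename]; exact .nil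
  | _, _, _, _, _, _, .cons h h₁, _, _, _, c => by
    simp only [SSp.rename]; exact .cons (h.rename c) (h₁.rename c)
termination_by structural _ _ _ _ _ _ h => h

end

/-- The relation `SubSSp` after forgetting the last observation; it is trivial where no observation
of the entries is left. -/
def SubSSpTrunc : {k : ℕ} → Tm k → ℕ → STy → SSp (k + 1) → SSp (k + 1) → Prop
  | 0, _, _, _, _, _ => True
  | k + 1, N, x, τ, S, S' => SubSSp (k := k) N.trunc x τ S.truncAux S'.truncAux

mutual

theorem SubTm.truncAux : {k : ℕ} → {N : Tm k} → {x : ℕ} → {τ : STy} → {M M' : Tm k} →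
    (h : SubTm N x τ M M') → SubTm N.truncAux x τ M.truncAux M'.truncAux
  | _, _, _, _, _, _, .zero .. => .zero ..
  | _, _, _, _, _, _, .neu (k := 0) h => .zero ..
  | _, _, _, _, _, _, .neu (k := _ + 1) h => by
    simp only [Tm.truncAux]; exact .neu h.truncAux
  | _, _, _, _, _, _, .lam (k := 0) h => .zero ..
  | _, _, _, _, _, _, .lam (k := _ + 1) (N := N) h => by
    have h' := h.truncAux
    simp only [Tm.truncAux]
    rw [Tm.weaken, Tm.truncAux_rename] at h'
    exact .lam h'
termination_by structural _ _ _ _ _ _ h => h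

theorem SubNe.truncAux : {k : ℕ} → {N : Tm k} → {x : ℕ} → {τ : STy} → {M M' : Neu k} →
    (h : SubNe N x τ M M') → SubNe N.truncAux x τ M.truncAux M'.truncAux
  | _, _, _, _, _, _, .zero .. => .zero ..
  | _, _, _, _, _, _, .var_eq (k := 0) h h₁ => .zero ..
  | _, _, _, _, _, _, .var_eq (k := _ + 1) h h₁ => by
    simp only [Neu.truncAux]; exact .var_eq h.truncAux h₁.truncAux
  | _, _, _, _, _, _, .var_lt (k := 0) hy h => .zero ..
  | _, _, _, _, _, _, .var_lt (k := _ + 1) hy h => by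
    simp only [Neu.truncAux]; exact .var_lt hy h.truncAux
  | _, _, _, _, _, _, .var_gt (k := 0) hy h => .zero ..
  | _, _, _, _, _, _, .var_gt (k := _ + 1) hy h => by
    simp only [Neu.truncAux]; exact .var_gt hy h.truncAux
  | _, _, _, _, _, _, .con (k := 0) h => .zero ..
  | _, _, _, _, _, _, .con (k := _ + 1) h => by
    have h' := h.truncAux
    simp only [Neu.truncAux]; exact .con h'
termination_by structural _ _ _ _ _ _ h => h

theorem SubCSp.truncAux : {k : ℕ} → {N : Tm k} → {x : ℕ} → {τ : STy} → {M M' : CSp k} →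
    (h : SubCSp N x τ M M') → SubCSp N.truncAux x τ M.truncAux M'.truncAux
  | _, _, _, _, _, _, .zero .. => .zero ..
  | _, _, _, _, _, _, .nil (k := 0) => .zero ..
  | _, _, _, _, _, _, .nil (k := _ + 1) => by simp only [CSp.truncAux]; exact .nil
  | _, _, _, _, _, _, .cons (k := 0) h h₁ => .zero ..
  | _, _, _, _, _, _, .cons (k := _ + 1) h h₁ => by
    simp only [CSp.truncAux]; exact .cons h.truncAux h₁.truncAux
termination_by structural _ _ _ _ _ _ h => h

theorem AppCSp.truncAux : {k : ℕ} → {T : CSp k} → {τ : STy} → {N : Tm k} → {R : Neu k} →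
    (h : AppCSp T τ N R) → AppCSp T.truncAux τ N.truncAux R.truncAux
  | _, _, _, _, _, .zero .. => .zero ..
  | _, _, _, _, _, .nil (k := 0) => .zero ..
  | _, _, _, _, _, .nil (k := _ + 1) => by simp only [CSp.truncAux, Tm.truncAux]; exact .nil
  | _, _, _, _, _, .cons (k := 0) h h₁ => .zero ..
  | _, _, _, _, _, .cons (k := _ + 1) h h₁ => by
    simp only [CSp.truncAux, Tm.truncAux]; exact .cons h.truncAux h₁.truncAux
termination_by structural _ _ _ _ _ h => h

theorem SubSSp.truncAux : {k : ℕ} → {N : Tm k} → {x : ℕ} → {τ : STy} → {M M' : SSp (k + 1)} →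
    (h : SubSSp N x τ M M') → SubSSpTrunc N x τ M M'
  | 0, _, _, _, _, _, .nil => trivial
  | 0, _, _, _, _, _, .cons h h₁ => trivial
  | _ + 1, _, _, _, _, _, .nil => by simp only [SubSSpTrunc, SSp.truncAux]; exact .nil
  | _ + 1, _, _, _, _, _, .cons h h₁ => by
    have h₂ := h₁.truncAux
    simp only [SubSSpTrunc, SSp.truncAux] at h₂ ⊢; exact .cons h.truncAux h₂
termination_by structural _ _ _ _ _ _ h => h

end

theorem SubTm.trunc {k : ℕ} {N : Tm (k + 1)} {x : ℕ} {τ : STy} {M M' : Tm (k + 1)}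
    (h : SubTm N x τ M M') : SubTm N.trunc x τ M.trunc M'.trunc := h.truncAux

mutual

/-- Substitution for a variable that does not occur. -/
theorem SubTm.vacuous : {k : ℕ} → (M : Tm k) → (N : Tm k) → (x : ℕ) → (τ : STy) →
    SubTm N x τ (M.rename (insRen x)) M
  | _, .unobs, _, _, _ => .zero ..
  | _, .lam M, N, x, τ => by
    simp only [Tm.rename, liftRen_insRen]; exact .lam (SubTm.vacuous M _ _ _)
  | _, .neu R, N, x, τ => by
    simp only [Tm.rename]; exact .neu (SubNe.vacuous R _ _ _)

theorem SubNe.vacuous : {k : ℕ} → (R : Neu k) → (N : Tm k) → (x : ℕ) → (τ : STy) →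
    SubNe N x τ (R.rename (insRen x)) R
  | _, .unobs, _, _, _ => .zero ..
  | _, .var y T, N, x, τ => by
    simp only [Neu.rename]; exact .var_ins _ (SubCSp.vacuous T _ _ _)
  | _, .con c S, N, x, τ => by
    simp only [Neu.rename]; exact .con (SubSSp.vacuous S _ _ _)

theorem SubCSp.vacuous : {k : ℕ} → (T : CSp k) → (N : Tm k) → (x : ℕ) → (τ : STy) →
    SubCSp N x τ (T.rename (insRen x)) T
  | _, .unobs, _, _, _ => .zero ..
  | _, .nil, N, x, τ => by simp only [CSp.rename]; exact .nil
  | _, .cons M T, N, x, τ => by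
    simp only [CSp.rename]; exact .cons (SubTm.vacuous M _ _ _) (SubCSp.vacuous T _ _ _)

theorem SubSSp.vacuous : {k : ℕ} → (S : SSp (k + 1)) → (N : Tm k) → (x : ℕ) → (τ : STy) →
    SubSSp N x τ (S.rename (insRen x)) S
  | _, .nil, N, x, τ => by simp only [SSp.rename]; exact .nil
  | _, .cons M S, N, x, τ => by
    simp only [SSp.rename]; exact .cons (SubTm.vacuous M _ _ _) (SubSSp.vacuous S _ _ _)

end

/-! ### Simple typing -/

/-- Simply typed contexts; variables outside the context are sent to `none`. -/
abbrev SCtx : Type := ℕ → Option STy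

/-- Insertion of a new variable `x` of type `τ`. -/
def insCtx (x : ℕ) (τ : STy) (γ : SCtx) : SCtx := fun i =>
  if i < x then γ i else if i = x then some τ else γ (i - 1)

theorem insCtx_self (x : ℕ) (τ : STy) (γ : SCtx) : insCtx x τ γ x = some τ := by
  simp [insCtx]

theorem insCtx_insRen (x : ℕ) (τ : STy) (γ : SCtx) (i : ℕ) :
    insCtx x τ γ (insRen x i) = γ i := by
  simp only [insCtx, insRen]; split_ifs <;> first | omega | rfl

theorem insCtx_zero_succ (τ : STy) (γ : SCtx) (i : ℕ) : insCtx 0 τ γ (i + 1) = γ i := by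
  simp [insCtx]

theorem insCtx_comm {x y : ℕ} (h : x ≤ y) (σ τ : STy) (γ : SCtx) :
    insCtx x σ (insCtx y τ γ) = insCtx (y + 1) τ (insCtx x σ γ) := by
  funext i
  simp only [insCtx]
  split_ifs <;> first | omega | rfl

/-- `ρ` is a renaming from the context `γ` to the context `γ'`. -/
def SRen (ρ : ℕ → ℕ) (γ γ' : SCtx) : Prop := ∀ x τ, γ x = some τ → γ' (ρ x) = some τ

theorem SRen.lift {ρ : ℕ → ℕ} {γ γ' : SCtx} (h : SRen ρ γ γ') (σ : STy) :
    SRen (liftRen ρ) (insCtx 0 σ γ) (insCtx 0 σ γ') := by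
  intro x τ hx
  cases x with
  | zero => simpa [insCtx, liftRen] using hx
  | succ x =>
    rw [insCtx_zero_succ] at hx
    simp only [liftRen, insCtx_zero_succ]
    exact h x τ hx

theorem SRen.insRen (x : ℕ) (σ : STy) (γ : SCtx) : SRen (insRen x) γ (insCtx x σ γ) := by
  intro y τ hy
  rw [insCtx_insRen, hy]

mutual

/-- `M` has the simple type `τ`. Constants carry no simple types: the entries of a suspended spine
have to be simply typed, but at arbitrary types. -/
inductive STm : {k : ℕ} → SCtx → Tm k → STy → Prop where
  | zero (γ : SCtx) (M : Tm 0) (τ : STy) : STm γ M τ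
  | neu {k : ℕ} {γ : SCtx} {R : Neu (k + 1)} : SNe γ R → STm γ (.neu R) .base
  | lam {k : ℕ} {γ : SCtx} {M : Tm (k + 1)} {σ τ : STy} :
      STm (insCtx 0 σ γ) M τ → STm γ (.lam M) (.arrow σ τ)

/-- `R` is a simply typed neutral term. -/
inductive SNe : {k : ℕ} → SCtx → Neu k → Prop where
  | zero (γ : SCtx) (R : Neu 0) : SNe γ R
  | var {k : ℕ} {γ : SCtx} {x : ℕ} {T : CSp (k + 1)} {τ : STy} :
      γ x = some τ → SCSp γ T τ → SNe γ (.var x T)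
  | con {k : ℕ} {γ : SCtx} {c : ConName} {S : SSp (k + 1)} : SSSp γ S → SNe γ (.con c S)

/-- `T` is a spine for a head of simple type `τ`. -/
inductive SCSp : {k : ℕ} → SCtx → CSp k → STy → Prop where
  | zero (γ : SCtx) (T : CSp 0) (τ : STy) : SCSp γ T τ
  | nil {k : ℕ} {γ : SCtx} : SCSp γ (.nil (k := k)) .base
  | cons {k : ℕ} {γ : SCtx} {M : Tm (k + 1)} {T : CSp (k + 1)} {σ τ : STy} :
      STm γ M σ → SCSp γ T τ → SCSp γ (.cons M T) (.arrow σ τ)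

/-- The entries of `S` are simply typed. -/
inductive SSSp : {k : ℕ} → SCtx → SSp k → Prop where
  | zero (γ : SCtx) (S : SSp 0) : SSSp γ S
  | nil {k : ℕ} {γ : SCtx} : SSSp γ (.nil (k := k))
  | cons {k : ℕ} {γ : SCtx} {M : Tm k} {S : SSp (k + 1)} {σ : STy} :
      STm γ M σ → SSSp γ S → SSSp γ (.cons M S)

end

mutual

theorem STm.rename : {k : ℕ} → {γ : SCtx} → {M : Tm k} → {τ : STy} → (h : STm γ M τ) →
    {ρ : ℕ → ℕ} → {γ' : SCtx} → SRen ρ γ γ' → STm γ' (M.rename ρ) τ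
  | _, _, _, _, .zero .., _, _, _ => .zero ..
  | _, _, _, _, .neu h, _, _, r => by simp only [Tm.rename]; exact .neu (h.rename r)
  | _, _, _, _, .lam h, _, _, r => by simp only [Tm.rename]; exact .lam (h.rename (r.lift _))
termination_by structural _ _ _ _ h => h

theorem SNe.rename : {k : ℕ} → {γ : SCtx} → {R : Neu k} → (h : SNe γ R) →
    {ρ : ℕ → ℕ} → {γ' : SCtx} → SRen ρ γ γ' → SNe γ' (R.rename ρ)
  | _, _, _, .zero .., _, _, _ => .zero ..
  | _, _, _, .var e h, _, _, r => by
    simp only [Neu.rename]; exact .var (r _ _ e) (h.rename r)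
  | _, _, _, .con h, _, _, r => by simp only [Neu.rename]; exact .con (h.rename r)
termination_by structural _ _ _ h => h

theorem SCSp.rename : {k : ℕ} → {γ : SCtx} → {T : CSp k} → {τ : STy} → (h : SCSp γ T τ) →
    {ρ : ℕ → ℕ} → {γ' : SCtx} → SRen ρ γ γ' → SCSp γ' (T.rename ρ) τ
  | _, _, _, _, .zero .., _, _, _ => .zero ..
  | _, _, _, _, .nil, _, _, _ => by simp only [CSp.rename]; exact .nil
  | _, _, _, _, .cons h h₁, _, _, r => by
    simp only [CSp.rename]; exact .cons (h.rename r) (h₁.rename r)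
termination_by structural _ _ _ _ h => h

theorem SSSp.rename : {k : ℕ} → {γ : SCtx} → {S : SSp k} → (h : SSSp γ S) →
    {ρ : ℕ → ℕ} → {γ' : SCtx} → SRen ρ γ γ' → SSSp γ' (S.rename ρ)
  | _, _, _, .zero .., _, _, _ => .zero ..
  | _, _, _, .nil, _, _, _ => by simp only [SSp.rename]; exact .nil
  | _, _, _, .cons h h₁, _, _, r => by
    simp only [SSp.rename]; exact .cons (h.rename r) (h₁.rename r)
termination_by structural _ _ _ h => h

end

/-- `ρ` and `ρ'` agree on the variables of `γ`. -/
def SAgree (ρ ρ' : ℕ → ℕ) (γ : SCtx) : Prop := ∀ x, γ x ≠ none → ρ x = ρ' x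

theorem SAgree.lift {ρ ρ' : ℕ → ℕ} {γ : SCtx} (h : SAgree ρ ρ' γ) (σ : STy) :
    SAgree (liftRen ρ) (liftRen ρ') (insCtx 0 σ γ) := by
  intro x hx
  cases x with
  | zero => rfl
  | succ x =>
    rw [insCtx_zero_succ] at hx
    simp only [liftRen, h x hx]

mutual

theorem STm.rename_congr : {k : ℕ} → {γ : SCtx} → {M : Tm k} → {τ : STy} → (h : STm γ M τ) →
    {ρ ρ' : ℕ → ℕ} → SAgree ρ ρ' γ → M.rename ρ = M.rename ρ'
  | _, _, _, _, .zero .., _, _, _ => Subsingleton.elim _ _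
  | _, _, _, _, .neu h, _, _, r => by simp only [Tm.rename, h.rename_congr r]
  | _, _, _, _, .lam h, _, _, r => by simp only [Tm.rename, h.rename_congr (r.lift _)]
termination_by structural _ _ _ _ h => h

theorem SNe.rename_congr : {k : ℕ} → {γ : SCtx} → {R : Neu k} → (h : SNe γ R) →
    {ρ ρ' : ℕ → ℕ} → SAgree ρ ρ' γ → R.rename ρ = R.rename ρ'
  | _, _, _, .zero .., _, _, _ => Subsingleton.elim _ _
  | _, _, _, .var e h, _, _, r => by
    simp only [Neu.rename, h.rename_congr r, r _ (by rw [e]; exact Option.some_ne_none _)]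
  | _, _, _, .con h, _, _, r => by simp only [Neu.rename, h.rename_congr r]
termination_by structural _ _ _ h => h

theorem SCSp.rename_congr : {k : ℕ} → {γ : SCtx} → {T : CSp k} → {τ : STy} → (h : SCSp γ T τ) →
    {ρ ρ' : ℕ → ℕ} → SAgree ρ ρ' γ → T.rename ρ = T.rename ρ'
  | _, _, _, _, .zero .., _, _, _ => Subsingleton.elim _ _
  | _, _, _, _, .nil, _, _, _ => by simp only [CSp.rename]
  | _, _, _, _, .cons h h₁, _, _, r => by
    simp only [CSp.rename, h.rename_congr r, h₁.rename_congr r]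
termination_by structural _ _ _ _ h => h

theorem SSSp.rename_congr : {k : ℕ} → {γ : SCtx} → {S : SSp k} → (h : SSSp γ S) →
    {ρ ρ' : ℕ → ℕ} → SAgree ρ ρ' γ → S.rename ρ = S.rename ρ'
  | _, _, _, .zero _ S, _, _, _ => by cases S; rfl
  | _, _, _, .nil, _, _, _ => by simp only [SSp.rename]
  | _, _, _, .cons h h₁, _, _, r => by
    simp only [SSp.rename, h.rename_congr r, h₁.rename_congr r]
termination_by structural _ _ _ h => h

end

mutual

theorem STm.truncAux : {k : ℕ} → {γ : SCtx} → {M : Tm k} → {τ : STy} → (h : STm γ M τ) →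
    STm γ M.truncAux τ
  | _, _, _, _, .zero .. => .zero ..
  | _, _, _, _, .neu (k := 0) h => .zero ..
  | _, _, _, _, .neu (k := _ + 1) h => by simp only [Tm.truncAux]; exact .neu h.truncAux
  | _, _, _, _, .lam (k := 0) h => .zero ..
  | _, _, _, _, .lam (k := _ + 1) h => by simp only [Tm.truncAux]; exact .lam h.truncAux
termination_by structural _ _ _ _ h => h

theorem SNe.truncAux : {k : ℕ} → {γ : SCtx} → {R : Neu k} → (h : SNe γ R) → SNe γ R.truncAux
  | _, _, _, .zero .. => .zero ..
  | _, _, _, .var (k := 0) e h => .zero ..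
  | _, _, _, .var (k := _ + 1) e h => by simp only [Neu.truncAux]; exact .var e h.truncAux
  | _, _, _, .con (k := 0) h => .zero ..
  | _, _, _, .con (k := _ + 1) h => by simp only [Neu.truncAux]; exact .con h.truncAux
termination_by structural _ _ _ h => h

theorem SCSp.truncAux : {k : ℕ} → {γ : SCtx} → {T : CSp k} → {τ : STy} → (h : SCSp γ T τ) →
    SCSp γ T.truncAux τ
  | _, _, _, _, .zero .. => .zero ..
  | _, _, _, _, .nil (k := 0) => .zero ..
  | _, _, _, _, .nil (k := _ + 1) => by simp only [CSp.truncAux]; exact .nil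
  | _, _, _, _, .cons (k := 0) h h₁ => .zero ..
  | _, _, _, _, .cons (k := _ + 1) h h₁ => by
    simp only [CSp.truncAux]; exact .cons h.truncAux h₁.truncAux
termination_by structural _ _ _ _ h => h

theorem SSSp.truncAux : {k : ℕ} → {γ : SCtx} → {S : SSp k} → (h : SSSp γ S) →
    SSSp γ S.truncAux
  | _, _, _, .zero .. => .zero ..
  | _, _, _, .nil (k := 0) => .zero ..
  | _, _, _, .nil (k := _ + 1) => by simp only [SSp.truncAux]; exact .nil
  | _, _, _, .cons (k := 0) h h₁ => .zero ..
  | _, _, _, .cons (k := _ + 1) h h₁ => by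
    simp only [SSp.truncAux]; exact .cons h.truncAux h₁.truncAux
termination_by structural _ _ _ h => h

end

theorem STm.trunc {k : ℕ} {γ : SCtx} {M : Tm (k + 1)} {τ : STy} (h : STm γ M τ) :
    STm γ M.trunc τ := h.truncAux

theorem STm.weaken_one {k : ℕ} {γ : SCtx} {M : Tm k} {τ : STy} (h : STm γ M τ) (σ : STy) :
    STm (insCtx 0 σ γ) (M.weaken 1) τ := by
  rw [Tm.weaken_one]
  exact h.rename (.insRen 0 σ γ)

/-! ### Hereditary substitution is defined on simply typed expressions -/

/-- Spine application at the simple type `τ` is defined on simply typed expressions. -/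
def AppTotal (τ : STy) : Prop :=
  ∀ {k : ℕ} {γ : SCtx} {T : CSp k} {N : Tm k}, SCSp γ T τ → STm γ N τ →
    ∃ R, AppCSp T τ N R ∧ SNe γ R

mutual

theorem STm.exists_sub_of_app {τ : STy} (H : AppTotal τ) :
    {k : ℕ} → (M : Tm k) → {γ : SCtx} → {N : Tm k} → {x : ℕ} → {σ : STy} →
    STm γ N τ → STm (insCtx x τ γ) M σ → ∃ M', SubTm N x τ M M' ∧ STm γ M' σ
  | _, .unobs, _, _, _, _, _, _ => ⟨_, .zero _ _ _ _ .unobs, .zero ..⟩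
  | _, .lam M, γ, N, x, _, hN, .lam h => by
    rw [insCtx_comm (Nat.zero_le x)] at h
    obtain ⟨M', h₁, h₂⟩ := STm.exists_sub_of_app H M (hN.weaken_one _) h
    exact ⟨_, .lam h₁, .lam h₂⟩
  | _, .neu R, γ, N, x, _, hN, .neu h => by
    obtain ⟨R', h₁, h₂⟩ := SNe.exists_sub_of_app H R hN h
    exact ⟨_, .neu h₁, .neu h₂⟩

theorem SNe.exists_sub_of_app {τ : STy} (H : AppTotal τ) :
    {k : ℕ} → (R : Neu k) → {γ : SCtx} → {N : Tm k} → {x : ℕ} →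
    STm γ N τ → SNe (insCtx x τ γ) R → ∃ R', SubNe N x τ R R' ∧ SNe γ R'
  | _, .unobs, _, _, _, _, _ => ⟨_, .zero _ _ _ _ .unobs, .zero ..⟩
  | _, .var y T, γ, N, x, hN, .var e h => by
    obtain ⟨T', h₁, h₂⟩ := SCSp.exists_sub_of_app H T hN h
    rcases eq_or_eq_insRen x y with rfl | ⟨z, rfl⟩
    · rw [insCtx_self] at e
      cases e
      obtain ⟨R, h₃, h₄⟩ := H h₂ hN
      exact ⟨R, .var_eq h₁ h₃, h₄⟩
    · rw [insCtx_insRen] at e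
      exact ⟨_, .var_ins z h₁, .var e h₂⟩
  | _, .con c S, γ, N, x, hN, .con h => by
    obtain ⟨S', h₁, h₂⟩ := SSSp.exists_sub_of_app H S hN.trunc h
    exact ⟨_, .con h₁, .con h₂⟩

theorem SCSp.exists_sub_of_app {τ : STy} (H : AppTotal τ) :
    {k : ℕ} → (T : CSp k) → {γ : SCtx} → {N : Tm k} → {x : ℕ} → {σ : STy} →
    STm γ N τ → SCSp (insCtx x τ γ) T σ → ∃ T', SubCSp N x τ T T' ∧ SCSp γ T' σ
  | _, .unobs, _, _, _, _, _, _ => ⟨_, .zero _ _ _ _ .unobs, .zero ..⟩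
  | _, .nil, γ, N, x, _, hN, .nil => ⟨_, .nil, .nil⟩
  | _, .cons M T, γ, N, x, _, hN, .cons h h' => by
    obtain ⟨M', h₁, h₂⟩ := STm.exists_sub_of_app H M hN h
    obtain ⟨T', h₃, h₄⟩ := SCSp.exists_sub_of_app H T hN h'
    exact ⟨_, .cons h₁ h₃, .cons h₂ h₄⟩

theorem SSSp.exists_sub_of_app {τ : STy} (H : AppTotal τ) :
    {k : ℕ} → (S : SSp (k + 1)) → {γ : SCtx} → {N : Tm k} → {x : ℕ} →
    STm γ N τ → SSSp (insCtx x τ γ) S → ∃ S', SubSSp N x τ S S' ∧ SSSp γ S'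
  | _, .nil, γ, N, x, hN, .nil => ⟨_, .nil, .nil⟩
  | _, .cons M S, γ, N, x, hN, .cons h h' => by
    obtain ⟨M', h₁, h₂⟩ := STm.exists_sub_of_app H M hN h
    obtain ⟨S', h₃, h₄⟩ := SSSp.exists_sub_of_app H S hN h'
    exact ⟨_, .cons h₁ h₃, .cons h₂ h₄⟩

end

theorem appTotal (τ : STy) : AppTotal τ := by
  induction τ with
  | base =>
    intro k γ T N hT hN
    cases hT with
    | zero => exact ⟨.unobs, .zero .., .zero ..⟩
    | nil => cases hN with | neu h => exact ⟨_, .nil, h⟩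
  | arrow a b iha ihb =>
    intro k γ T N hT hN
    cases hT with
    | zero => exact ⟨.unobs, .zero .., .zero ..⟩
    | cons h h' =>
      cases hN with
      | lam hM =>
        obtain ⟨M', h₁, h₂⟩ := STm.exists_sub_of_app iha _ h hM
        obtain ⟨R, h₃, h₄⟩ := ihb h' h₂
        exact ⟨R, .cons h₁ h₃, h₄⟩

theorem STm.exists_sub {k : ℕ} {γ : SCtx} {N M : Tm k} {x : ℕ} {τ σ : STy} (hN : STm γ N τ)
    (hM : STm (insCtx x τ γ) M σ) : ∃ M', SubTm N x τ M M' ∧ STm γ M' σ :=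
  exists_sub_of_app (appTotal τ) M hN hM

theorem SCSp.exists_sub {k : ℕ} {γ : SCtx} {N : Tm k} {T : CSp k} {x : ℕ} {τ σ : STy}
    (hN : STm γ N τ) (hT : SCSp (insCtx x τ γ) T σ) : ∃ T', SubCSp N x τ T T' ∧ SCSp γ T' σ :=
  exists_sub_of_app (appTotal τ) T hN hT

theorem SSSp.exists_sub {k : ℕ} {γ : SCtx} {N : Tm k} {S : SSp (k + 1)} {x : ℕ} {τ : STy}
    (hN : STm γ N τ) (hS : SSSp (insCtx x τ γ) S) : ∃ S', SubSSp N x τ S S' ∧ SSSp γ S' :=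
  exists_sub_of_app (appTotal τ) S hN hS

theorem STm.sub {k : ℕ} {γ : SCtx} {N M M' : Tm k} {x : ℕ} {τ σ : STy} (hN : STm γ N τ)
    (hM : STm (insCtx x τ γ) M σ) (h : SubTm N x τ M M') : STm γ M' σ := by
  obtain ⟨M₁, h₁, h₂⟩ := hN.exists_sub hM
  rwa [h.det h₁]

theorem SCSp.sub {k : ℕ} {γ : SCtx} {N : Tm k} {T T' : CSp k} {x : ℕ} {τ σ : STy}
    (hN : STm γ N τ) (hT : SCSp (insCtx x τ γ) T σ) (h : SubCSp N x τ T T') : SCSp γ T' σ := by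
  obtain ⟨T₁, h₁, h₂⟩ := SCSp.exists_sub hN hT
  rwa [h.det h₁]

theorem SSSp.sub {k : ℕ} {γ : SCtx} {N : Tm k} {S S' : SSp (k + 1)} {x : ℕ} {τ : STy}
    (hN : STm γ N τ) (hS : SSSp (insCtx x τ γ) S) (h : SubSSp N x τ S S') : SSSp γ S' := by
  obtain ⟨S₁, h₁, h₂⟩ := SSSp.exists_sub hN hS
  rwa [h.det h₁]

/-! ### Commutation of hereditary substitutions -/

/-- The situation of `[N₂/y][N₁/x] = [[N₂/y]N₁/x][N₂/y]`, where `x` is declared after `y`. -/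
structure Crossing {k : ℕ} (γ : SCtx) (x y : ℕ) (τ₁ τ₂ : STy) (N₁ N₁' N₂ : Tm k) : Prop where
  le : x ≤ y
  ty₁ : STm (insCtx y τ₂ γ) N₁ τ₁
  ty₂ : STm γ N₂ τ₂
  sub : SubTm N₂ y τ₂ N₁ N₁'

theorem Crossing.ty₁' {k : ℕ} {γ : SCtx} {x y : ℕ} {τ₁ τ₂ : STy} {N₁ N₁' N₂ : Tm k}
    (c : Crossing γ x y τ₁ τ₂ N₁ N₁' N₂) : STm γ N₁' τ₁ := c.ty₂.sub c.ty₁ c.sub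

theorem Crossing.ty₂' {k : ℕ} {γ : SCtx} {x y : ℕ} {τ₁ τ₂ : STy} {N₁ N₁' N₂ : Tm k}
    (c : Crossing γ x y τ₁ τ₂ N₁ N₁' N₂) : STm (insCtx x τ₁ γ) (N₂.rename (insRen x)) τ₂ :=
  c.ty₂.rename (.insRen _ _ _)

theorem Crossing.lift {k : ℕ} {γ : SCtx} {x y : ℕ} {τ₁ τ₂ : STy} {N₁ N₁' N₂ : Tm k}
    (c : Crossing γ x y τ₁ τ₂ N₁ N₁' N₂) (σ : STy) :
    Crossing (insCtx 0 σ γ) (x + 1) (y + 1) τ₁ τ₂ (N₁.weaken 1) (N₁'.weaken 1) (N₂.weaken 1) where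
  le := Nat.succ_le_succ c.le
  ty₁ := by
    rw [← insCtx_comm (Nat.zero_le y)]
    exact c.ty₁.weaken_one σ
  ty₂ := c.ty₂.weaken_one σ
  sub := by
    simp only [Tm.weaken_one]
    exact c.sub.rename (.insert (Nat.zero_le y))

theorem Crossing.trunc {k : ℕ} {γ : SCtx} {x y : ℕ} {τ₁ τ₂ : STy} {N₁ N₁' N₂ : Tm (k + 1)}
    (c : Crossing γ x y τ₁ τ₂ N₁ N₁' N₂) :
    Crossing γ x y τ₁ τ₂ N₁.trunc N₁'.trunc N₂.trunc where
  le := c.le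
  ty₁ := c.ty₁.trunc
  ty₂ := c.ty₂.trunc
  sub := c.sub.trunc

/-- Spine application at `τ` commutes with substitution at `τ₂`. -/
def AppCommutes (τ τ₂ : STy) : Prop :=
  ∀ {k : ℕ} {γ : SCtx} {y : ℕ} {N₂ N N' : Tm k} {T T' : CSp k} {R R' R'' : Neu k},
    STm γ N₂ τ₂ → SCSp (insCtx y τ₂ γ) T τ → STm (insCtx y τ₂ γ) N τ → AppCSp T τ N R →
    SubCSp N₂ y τ₂ T T' → SubTm N₂ y τ₂ N N' → SubNe N₂ y τ₂ R R' → AppCSp T' τ N' R'' →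
    R' = R''

theorem Tm.rename_insRen_weaken_one {k : ℕ} (N : Tm k) (x : ℕ) :
    (N.rename (insRen x)).weaken 1 = (N.weaken 1).rename (insRen (x + 1)) := by
  rw [Tm.rename_weaken_one, liftRen_insRen]

mutual

theorem SubTm.comm_of_app {τ₁ τ₂ : STy} (H₁ : AppCommutes τ₁ τ₂) (H₂ : AppCommutes τ₂ τ₁) :
    {k : ℕ} → (M : Tm k) → {M₁ M₂ M₃ M₄ : Tm k} → {γ : SCtx} → {x y : ℕ} →
    {N₁ N₁' N₂ : Tm k} → {σ : STy} → Crossing γ x y τ₁ τ₂ N₁ N₁' N₂ →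
    STm (insCtx x τ₁ (insCtx y τ₂ γ)) M σ →
    SubTm N₁ x τ₁ M M₁ → SubTm N₂ y τ₂ M₁ M₃ →
    SubTm (N₂.rename (insRen x)) (y + 1) τ₂ M M₂ → SubTm N₁' x τ₁ M₂ M₄ → M₃ = M₄
  | _, .unobs, _, _, _, _, _, _, _, _, _, _, _, _, _, _, _, _, _ => Subsingleton.elim _ _
  | _, .lam M, _, _, _, _, γ, x, y, _, _, _, _, c, .lam h, .lam h₁, h₃, .lam h₂, h₄ => by
    cases h₃ with | lam h₃ =>
    cases h₄ with | lam h₄ =>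
    rw [insCtx_comm (Nat.zero_le x), insCtx_comm (Nat.zero_le y)] at h
    rw [Tm.rename_insRen_weaken_one] at h₂
    rw [SubTm.comm_of_app H₁ H₂ M (c.lift _) h h₁ h₃ h₂ h₄]
  | _, .neu R, _, _, _, _, γ, x, y, _, _, _, _, c, .neu h, .neu h₁, h₃, .neu h₂, h₄ => by
    cases h₃ with | neu h₃ =>
    cases h₄ with | neu h₄ =>
    rw [SubNe.comm_of_app H₁ H₂ R c h h₁ h₃ h₂ h₄]

theorem SubNe.comm_of_app {τ₁ τ₂ : STy} (H₁ : AppCommutes τ₁ τ₂) (H₂ : AppCommutes τ₂ τ₁) :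
    {k : ℕ} → (R : Neu k) → {R₁ R₂ R₃ R₄ : Neu k} → {γ : SCtx} → {x y : ℕ} →
    {N₁ N₁' N₂ : Tm k} → Crossing γ x y τ₁ τ₂ N₁ N₁' N₂ →
    SNe (insCtx x τ₁ (insCtx y τ₂ γ)) R →
    SubNe N₁ x τ₁ R R₁ → SubNe N₂ y τ₂ R₁ R₃ →
    SubNe (N₂.rename (insRen x)) (y + 1) τ₂ R R₂ → SubNe N₁' x τ₁ R₂ R₄ → R₃ = R₄
  | _, .unobs, _, _, _, _, _, _, _, _, _, _, _, _, _, _, _, _ => Subsingleton.elim _ _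
  | _, .var z T, R₁, R₂, R₃, R₄, γ, x, y, N₁, N₁', N₂, c, .var e h, h₁, h₃, h₂, h₄ => by
    have hh := h
    rw [insCtx_comm c.le] at hh
    rcases eq_or_eq_insRen x z with rfl | ⟨z, rfl⟩
    · rw [insCtx_self] at e
      cases e
      obtain ⟨T₁, a₁, b₁⟩ := h₁.inv_var
      have ez : z = insRen (y + 1) z := by simp [insRen, Nat.lt_succ_of_le c.le]
      have h₂' : SubNe (N₂.rename (insRen z)) (y + 1) τ₂ (.var (insRen (y + 1) z) T) R₂ := by
        rw [← ez]; exact h₂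
      obtain ⟨T₂, a₂, rfl⟩ := h₂'.inv_var_ins
      obtain ⟨T₄, a₄, b₄⟩ := h₄.inv_var
      have hT₁ := SCSp.sub c.ty₁ h a₁
      obtain ⟨T₃, a₃, -⟩ := SCSp.exists_sub c.ty₂ hT₁
      have et := SubCSp.comm_of_app H₁ H₂ T c h a₁ a₃ a₂ a₄
      subst et
      exact H₁ c.ty₂ hT₁ c.ty₁ b₁ a₃ c.sub h₃ b₄
    · obtain ⟨T₁, a₁, rfl⟩ := h₁.inv_var_ins
      rcases eq_or_eq_insRen y z with rfl | ⟨w, rfl⟩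
      · rw [insCtx_insRen, insCtx_self] at e
        cases e
        have ez : insRen x z = z + 1 := by simp [insRen, not_lt.2 c.le]
        rw [ez] at h₂
        obtain ⟨T₂, a₂, b₂⟩ := h₂.inv_var
        obtain ⟨T₃, a₃, b₃⟩ := h₃.inv_var
        have hT₂ := SCSp.sub c.ty₂' hh a₂
        obtain ⟨T₄, a₄, -⟩ := SCSp.exists_sub c.ty₁' hT₂
        have et := SubCSp.comm_of_app H₁ H₂ T c h a₁ a₃ a₂ a₄
        subst et
        exact (H₂ c.ty₁' hT₂ c.ty₂' b₂ a₄ (.vacuous _ _ _ _) h₄ b₃).symm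
      · rw [insRen_insRen c.le] at h₂
        obtain ⟨T₂, a₂, rfl⟩ := h₂.inv_var_ins
        obtain ⟨T₃, a₃, rfl⟩ := h₃.inv_var_ins
        obtain ⟨T₄, a₄, rfl⟩ := h₄.inv_var_ins
        rw [SubCSp.comm_of_app H₁ H₂ T c h a₁ a₃ a₂ a₄]
  | _, .con _ S, _, _, _, _, γ, x, y, _, _, _, c, .con h, .con h₁, h₃, .con h₂, h₄ => by
    cases h₃ with | con h₃ =>
    cases h₄ with | con h₄ =>
    rw [Tm.trunc_rename] at h₂
    rw [SubSSp.comm_of_app H₁ H₂ S c.trunc h h₁ h₃ h₂ h₄]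

theorem SubCSp.comm_of_app {τ₁ τ₂ : STy} (H₁ : AppCommutes τ₁ τ₂) (H₂ : AppCommutes τ₂ τ₁) :
    {k : ℕ} → (T : CSp k) → {T₁ T₂ T₃ T₄ : CSp k} → {γ : SCtx} → {x y : ℕ} →
    {N₁ N₁' N₂ : Tm k} → {σ : STy} → Crossing γ x y τ₁ τ₂ N₁ N₁' N₂ →
    SCSp (insCtx x τ₁ (insCtx y τ₂ γ)) T σ →
    SubCSp N₁ x τ₁ T T₁ → SubCSp N₂ y τ₂ T₁ T₃ →
    SubCSp (N₂.rename (insRen x)) (y + 1) τ₂ T T₂ → SubCSp N₁' x τ₁ T₂ T₄ → T₃ = T₄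
  | _, .unobs, _, _, _, _, _, _, _, _, _, _, _, _, _, _, _, _, _ => Subsingleton.elim _ _
  | _, .nil, _, _, _, _, γ, x, y, _, _, _, _, c, .nil, .nil, h₃, .nil, h₄ => by
    cases h₃
    cases h₄
    rfl
  | _, .cons M T, _, _, _, _, γ, x, y, _, _, _, _, c, .cons h h', .cons h₁ h₁', h₃,
      .cons h₂ h₂', h₄ => by
    cases h₃ with | cons h₃ h₃' =>
    cases h₄ with | cons h₄ h₄' =>
    rw [SubTm.comm_of_app H₁ H₂ M c h h₁ h₃ h₂ h₄,
      SubCSp.comm_of_app H₁ H₂ T c h' h₁' h₃' h₂' h₄']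

theorem SubSSp.comm_of_app {τ₁ τ₂ : STy} (H₁ : AppCommutes τ₁ τ₂) (H₂ : AppCommutes τ₂ τ₁) :
    {k : ℕ} → (S : SSp (k + 1)) → {S₁ S₂ S₃ S₄ : SSp (k + 1)} → {γ : SCtx} → {x y : ℕ} →
    {N₁ N₁' N₂ : Tm k} → Crossing γ x y τ₁ τ₂ N₁ N₁' N₂ →
    SSSp (insCtx x τ₁ (insCtx y τ₂ γ)) S →
    SubSSp N₁ x τ₁ S S₁ → SubSSp N₂ y τ₂ S₁ S₃ →
    SubSSp (N₂.rename (insRen x)) (y + 1) τ₂ S S₂ → SubSSp N₁' x τ₁ S₂ S₄ → S₃ = S₄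
  | _, .nil, _, _, _, _, γ, x, y, _, _, _, c, .nil, .nil, h₃, .nil, h₄ => by
    cases h₃
    cases h₄
    rfl
  | _, .cons M S, _, _, _, _, γ, x, y, _, _, _, c, .cons h h', .cons h₁ h₁', h₃,
      .cons h₂ h₂', h₄ => by
    cases h₃ with | cons h₃ h₃' =>
    cases h₄ with | cons h₄ h₄' =>
    rw [SubTm.comm_of_app H₁ H₂ M c h h₁ h₃ h₂ h₄,
      SubSSp.comm_of_app H₁ H₂ S c h' h₁' h₃' h₂' h₄']

end

/-- The number of constructors of a simple type. -/
def STy.size : STy → ℕ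
  | .base => 1
  | .arrow a b => a.size + b.size + 1

theorem appCommutes_of_lt (n : ℕ)
    (H : ∀ τ τ₂ : STy, τ.size + τ₂.size < n → AppCommutes τ τ₂) (τ τ₂ : STy)
    (hn : τ.size + τ₂.size ≤ n) : AppCommutes τ τ₂ := by
  induction τ with
  | base =>
    intro k γ y N₂ N N' T T' R R' R'' hN₂ hT hN ha hT' hN' hR' ha'
    cases ha with
    | zero => exact Subsingleton.elim _ _
    | nil =>
      cases hT'
      cases hN' with | neu hN' =>
      cases ha'
      exact hR'.det hN'
  | arrow a b _ ihb =>
    intro k γ y N₂ N N' T T' R R' R'' hN₂ hT hN ha hT' hN' hR' ha'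
    simp only [STy.size] at hn
    cases ha with
    | zero => exact Subsingleton.elim _ _
    | cons h₁ ha =>
      cases hT' with | cons h₀ hT' =>
      cases hN' with | lam h₂ =>
      cases ha' with | cons h₄ ha' =>
      cases hT with | cons hN₀ hT =>
      cases hN with | lam hM =>
      have hM' := hN₀.sub hM h₁
      obtain ⟨M₃, h₃, -⟩ := hN₂.exists_sub hM'
      rw [Tm.weaken_one] at h₂
      have e := SubTm.comm_of_app (H a τ₂ (by omega)) (H τ₂ a (by omega)) _
        ⟨Nat.zero_le y, hN₀, hN₂, h₀⟩ hM h₁ h₃ h₂ h₄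
      subst e
      exact ihb (by omega) hN₂ hT hM' ha hT' h₃ hR' ha'

theorem appCommutes (τ τ₂ : STy) : AppCommutes τ τ₂ := by
  generalize hn : τ.size + τ₂.size = n
  induction n using Nat.strong_induction_on generalizing τ τ₂ with
  | _ n ih => exact appCommutes_of_lt n (fun a b h => ih _ h a b rfl) τ τ₂ hn.le

theorem SubSSp.comm {τ₁ τ₂ : STy} {k : ℕ} {S S₁ S₂ S₃ S₄ : SSp (k + 1)} {γ : SCtx} {x y : ℕ}
    {N₁ N₁' N₂ : Tm k} (c : Crossing γ x y τ₁ τ₂ N₁ N₁' N₂)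
    (h : SSSp (insCtx x τ₁ (insCtx y τ₂ γ)) S)
    (h₁ : SubSSp N₁ x τ₁ S S₁) (h₃ : SubSSp N₂ y τ₂ S₁ S₃)
    (h₂ : SubSSp (N₂.rename (insRen x)) (y + 1) τ₂ S S₂) (h₄ : SubSSp N₁' x τ₁ S₂ S₄) :
    S₃ = S₄ :=
  SubSSp.comm_of_app (appCommutes _ _) (appCommutes _ _) S c h h₁ h₃ h₂ h₄

mutual

theorem Tm.rename_id : {k : ℕ} → (M : Tm k) → M.rename id = M
  | _, .unobs => by simp [Tm.rename]
  | _, .lam M => by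
    have : liftRen id = id := by funext i; cases i <;> rfl
    simp [Tm.rename, this, M.rename_id]
  | _, .neu R => by simp [Tm.rename, R.rename_id]

theorem Neu.rename_id : {k : ℕ} → (R : Neu k) → R.rename id = R
  | _, .unobs => by simp [Neu.rename]
  | _, .var x T => by simp [Neu.rename, T.rename_id]
  | _, .con c S => by simp [Neu.rename, S.rename_id]

theorem CSp.rename_id : {k : ℕ} → (T : CSp k) → T.rename id = T
  | _, .unobs => by simp [CSp.rename]
  | _, .nil => by simp [CSp.rename]
  | _, .cons M T => by simp [CSp.rename, M.rename_id, T.rename_id]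

theorem SSp.rename_id : {k : ℕ} → (S : SSp k) → S.rename id = S
  | _, .unobs => by simp [SSp.rename]
  | _, .nil => by simp [SSp.rename]
  | _, .cons M S => by simp [SSp.rename, M.rename_id, S.rename_id]

end

theorem Tm.weaken_zero {k : ℕ} (M : Tm k) : M.weaken 0 = M := M.rename_id

theorem Tm.weaken_weaken_one {k : ℕ} (M : Tm k) (n : ℕ) :
    (M.weaken n).weaken 1 = M.weaken (n + 1) := by
  simp only [Tm.weaken, Tm.rename_rename]; rfl

/-! ### Renaming and truncation of types and kinds -/

/-- Renaming of the free variables. -/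
def Kd.rename : {k : ℕ} → (ℕ → ℕ) → Kd k → Kd k
  | _, _, .unobs => .unobs
  | _, _, .type => .type
  | _, _, .cotype => .cotype
  | _, ρ, .pi A K => .pi (A.rename ρ) (K.rename (liftRen ρ))

theorem ATy.rename_rename {k : ℕ} (P : ATy k) (ρ ρ' : ℕ → ℕ) :
    (P.rename ρ').rename ρ = P.rename (ρ ∘ ρ') := by
  cases P <;> simp [ATy.rename, SSp.rename_rename]

theorem Ty.rename_rename : {k : ℕ} → (A : Ty k) → (ρ ρ' : ℕ → ℕ) →
    (A.rename ρ').rename ρ = A.rename (ρ ∘ ρ')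
  | _, .unobs, _, _ => by simp [Ty.rename]
  | _, .atom P, _, _ => by simp [Ty.rename, P.rename_rename]
  | _, .pi B A, _, _ => by simp [Ty.rename, B.rename_rename, A.rename_rename, liftRen_comp]

theorem Ty.rename_id : {k : ℕ} → (A : Ty k) → A.rename id = A
  | _, .unobs => by simp [Ty.rename]
  | _, .atom (.fam a S) => by simp [Ty.rename, ATy.rename, S.rename_id]
  | _, .pi B A => by
    have : liftRen id = id := by funext i; cases i <;> rfl
    simp [Ty.rename, B.rename_id, A.rename_id, this]

theorem Kd.rename_id : {k : ℕ} → (K : Kd k) → K.rename id = K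
  | _, .unobs => by simp [Kd.rename]
  | _, .type => by simp [Kd.rename]
  | _, .cotype => by simp [Kd.rename]
  | _, .pi A K => by
    have : liftRen id = id := by funext i; cases i <;> rfl
    simp [Kd.rename, A.rename_id, K.rename_id, this]

theorem Ty.erase_rename : {k : ℕ} → (A : Ty k) → (ρ : ℕ → ℕ) → (A.rename ρ).erase = A.erase
  | _, .unobs, _ => by simp [Ty.rename]
  | _, .atom P, _ => by simp [Ty.rename, Ty.erase]
  | _, .pi B A, _ => by simp [Ty.rename, Ty.erase, B.erase_rename, A.erase_rename]

theorem Ty.erase_weaken {k : ℕ} (A : Ty k) : A.weaken.erase = A.erase := A.erase_rename _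

theorem Ty.weaken_eq {k : ℕ} (A : Ty k) : A.weaken = A.rename (insRen 0) := by
  rw [insRen_zero]; rfl

theorem Ty.rename_weaken {k : ℕ} (A : Ty k) (ρ : ℕ → ℕ) :
    A.weaken.rename (liftRen ρ) = (A.rename ρ).weaken := by
  simp only [Ty.weaken, Ty.rename_rename]; rfl

theorem Ty.erase_trunc : {k : ℕ} → (A : Ty (k + 2)) → A.trunc.erase = A.erase
  | _, .atom P => by simp [Ty.trunc, Ty.truncAux, Ty.erase]
  | _, .pi B A => by
    have hB := B.erase_trunc
    have hA := A.erase_trunc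
    simp only [Ty.trunc, Ty.truncAux, Ty.erase] at *
    rw [hA, hB]

theorem ATy.truncAux_rename : {k : ℕ} → (P : ATy k) → (ρ : ℕ → ℕ) →
    (P.rename ρ).truncAux = P.truncAux.rename ρ
  | _, .unobs, _ => by simp [ATy.rename, ATy.truncAux]
  | _, .fam (k := 0) a S, ρ => by simp [ATy.rename, ATy.truncAux]
  | _, .fam (k := _ + 1) a S, ρ => by simp [ATy.rename, ATy.truncAux, S.truncAux_rename]

theorem Ty.truncAux_rename : {k : ℕ} → (A : Ty k) → (ρ : ℕ → ℕ) →
    (A.rename ρ).truncAux = A.truncAux.rename ρ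
  | _, .unobs, _ => by simp [Ty.rename, Ty.truncAux]
  | _, .atom (k := 0) P, ρ => by simp [Ty.rename, Ty.truncAux]
  | _, .atom (k := _ + 1) P, ρ => by simp [Ty.rename, Ty.truncAux, P.truncAux_rename]
  | _, .pi (k := 0) B A, ρ => by simp [Ty.rename, Ty.truncAux]
  | _, .pi (k := _ + 1) B A, ρ => by
    simp [Ty.rename, Ty.truncAux, B.truncAux_rename, A.truncAux_rename]

theorem Kd.truncAux_rename : {k : ℕ} → (K : Kd k) → (ρ : ℕ → ℕ) →
    (K.rename ρ).truncAux = K.truncAux.rename ρ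
  | _, .unobs, _ => by simp [Kd.rename, Kd.truncAux]
  | _, .type (k := 0), ρ => by simp [Kd.rename, Kd.truncAux]
  | _, .type (k := _ + 1), ρ => by simp [Kd.rename, Kd.truncAux]
  | _, .cotype (k := 0), ρ => by simp [Kd.rename, Kd.truncAux]
  | _, .cotype (k := _ + 1), ρ => by simp [Kd.rename, Kd.truncAux]
  | _, .pi (k := 0) A K, ρ => by simp [Kd.rename, Kd.truncAux]
  | _, .pi (k := _ + 1) A K, ρ => by
    simp [Kd.rename, Kd.truncAux, A.truncAux_rename, K.truncAux_rename]

theorem Ty.trunc_rename {k : ℕ} (A : Ty (k + 1)) (ρ : ℕ → ℕ) :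
    (A.rename ρ).trunc = A.trunc.rename ρ := A.truncAux_rename ρ

theorem Kd.trunc_rename {k : ℕ} (K : Kd (k + 1)) (ρ : ℕ → ℕ) :
    (K.rename ρ).trunc = K.trunc.rename ρ := K.truncAux_rename ρ

/-! ### Simply typed types and kinds -/

/-- The entries of the spine of `P` are simply typed. -/
inductive SATy : {k : ℕ} → SCtx → ATy k → Prop where
  | zero (γ : SCtx) (P : ATy 0) : SATy γ P
  | fam {k : ℕ} {γ : SCtx} {a : FamName} {S : SSp (k + 1)} : SSSp γ S → SATy γ (.fam a S)

/-- The terms in the type are simply typed. -/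
inductive STyOk : {k : ℕ} → SCtx → Ty k → Prop where
  | zero (γ : SCtx) (A : Ty 0) : STyOk γ A
  | atom {k : ℕ} {γ : SCtx} {P : ATy (k + 1)} : SATy γ P → STyOk γ (.atom P)
  | pi {k : ℕ} {γ : SCtx} {B A : Ty (k + 1)} :
      STyOk γ B → STyOk (insCtx 0 B.erase γ) A → STyOk γ (.pi B A)

/-- The terms in the kind are simply typed. -/
inductive SKd : {k : ℕ} → SCtx → Kd k → Prop where
  | zero (γ : SCtx) (K : Kd 0) : SKd γ K
  | type {k : ℕ} {γ : SCtx} : SKd γ (.type (k := k))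
  | cotype {k : ℕ} {γ : SCtx} : SKd γ (.cotype (k := k))
  | pi {k : ℕ} {γ : SCtx} {A : Ty (k + 1)} {K : Kd (k + 1)} :
      STyOk γ A → SKd (insCtx 0 A.erase γ) K → SKd γ (.pi A K)

theorem SATy.rename {k : ℕ} {γ γ' : SCtx} {P : ATy k} {ρ : ℕ → ℕ} (h : SATy γ P)
    (r : SRen ρ γ γ') : SATy γ' (P.rename ρ) := by
  cases h with
  | zero => exact .zero ..
  | fam h => simp only [ATy.rename]; exact .fam (h.rename r)

theorem STyOk.rename {k : ℕ} {γ γ' : SCtx} {A : Ty k} {ρ : ℕ → ℕ} (h : STyOk γ A)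
    (r : SRen ρ γ γ') : STyOk γ' (A.rename ρ) := by
  induction h generalizing γ' ρ with
  | zero => exact .zero ..
  | atom h => simp only [Ty.rename]; exact .atom (h.rename r)
  | pi _ _ ihB ihA =>
    simp only [Ty.rename]
    refine .pi (ihB r) ?_
    rw [Ty.erase_rename]
    exact ihA (r.lift _)

theorem SKd.rename {k : ℕ} {γ γ' : SCtx} {K : Kd k} {ρ : ℕ → ℕ} (h : SKd γ K)
    (r : SRen ρ γ γ') : SKd γ' (K.rename ρ) := by
  induction h generalizing γ' ρ with
  | zero => exact .zero ..
  | type => simp only [Kd.rename]; exact .type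
  | cotype => simp only [Kd.rename]; exact .cotype
  | pi h _ ih =>
    simp only [Kd.rename]
    refine .pi (h.rename r) ?_
    rw [Ty.erase_rename]
    exact ih (r.lift _)

theorem STyOk.rename_congr {k : ℕ} {γ : SCtx} {A : Ty k} {ρ ρ' : ℕ → ℕ} (h : STyOk γ A)
    (r : SAgree ρ ρ' γ) : A.rename ρ = A.rename ρ' := by
  induction h generalizing ρ ρ' with
  | zero => exact Subsingleton.elim _ _
  | atom h => cases h with | fam h => simp only [Ty.rename, ATy.rename, h.rename_congr r]
  | pi _ _ ihB ihA => simp only [Ty.rename, ihB r, ihA (r.lift _)]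

theorem SKd.rename_congr {k : ℕ} {γ : SCtx} {K : Kd k} {ρ ρ' : ℕ → ℕ} (h : SKd γ K)
    (r : SAgree ρ ρ' γ) : K.rename ρ = K.rename ρ' := by
  induction h generalizing ρ ρ' with
  | zero _ K => cases K; simp only [Kd.rename]
  | type => simp only [Kd.rename]
  | cotype => simp only [Kd.rename]
  | pi h _ ih => simp only [Kd.rename, h.rename_congr r, ih (r.lift _)]

/-- The empty simply typed context. -/
def emptySCtx : SCtx := fun _ => none

theorem STyOk.rename_eq {k : ℕ} {A : Ty k} (h : STyOk emptySCtx A) (ρ : ℕ → ℕ) :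
    A.rename ρ = A := by
  rw [h.rename_congr (ρ' := id) (fun x hx => absurd rfl hx), Ty.rename_id]

theorem SKd.rename_eq {k : ℕ} {K : Kd k} (h : SKd emptySCtx K) (ρ : ℕ → ℕ) :
    K.rename ρ = K := by
  rw [h.rename_congr (ρ' := id) (fun x hx => absurd rfl hx), Kd.rename_id]

theorem STyOk.of_empty {k : ℕ} {A : Ty k} (h : STyOk emptySCtx A) (γ : SCtx) : STyOk γ A := by
  have := h.rename (ρ := id) (γ' := γ) (fun x τ hx => by cases hx)
  rwa [Ty.rename_id] at this

theorem SKd.of_empty {k : ℕ} {K : Kd k} (h : SKd emptySCtx K) (γ : SCtx) : SKd γ K := by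
  have := h.rename (ρ := id) (γ' := γ) (fun x τ hx => by cases hx)
  rwa [Kd.rename_id] at this

/-! ### Hereditary substitution in types and kinds -/

theorem SubATy.det {k : ℕ} {N : Tm k} {x : ℕ} {τ : STy} {P P₁ P₂ : ATy (k + 1)}
    (h₁ : SubATy N x τ P P₁) (h₂ : SubATy N x τ P P₂) : P₁ = P₂ := by
  cases h₁ with | fam h₁ =>
  cases h₂ with | fam h₂ => rw [h₁.det h₂]

theorem SubTy.det {k : ℕ} {N : Tm k} {x : ℕ} {τ : STy} {A A₁ A₂ : Ty (k + 1)}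
    (h₁ : SubTy N x τ A A₁) (h₂ : SubTy N x τ A A₂) : A₁ = A₂ := by
  induction h₁ generalizing A₂ with
  | atom h₁ => cases h₂ with | atom h₂ => rw [h₁.det h₂]
  | pi _ _ ihB ihA => cases h₂ with | pi h h' => rw [ihB h, ihA h']

theorem SubKd.det {k : ℕ} {N : Tm k} {x : ℕ} {τ : STy} {K K₁ K₂ : Kd (k + 1)}
    (h₁ : SubKd N x τ K K₁) (h₂ : SubKd N x τ K K₂) : K₁ = K₂ := by
  induction h₁ generalizing K₂ with
  | type => cases h₂; rfl
  | cotype => cases h₂; rfl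
  | pi hA _ ih => cases h₂ with | pi h h' => rw [hA.det h, ih h']

theorem SubTy.erase_eq {k : ℕ} {N : Tm k} {x : ℕ} {τ : STy} {A A' : Ty (k + 1)}
    (h : SubTy N x τ A A') : A'.erase = A.erase := by
  induction h with
  | atom => simp only [Ty.erase]
  | pi _ _ ihB ihA => simp only [Ty.erase, ihB, ihA]

theorem SubATy.rename {k : ℕ} {N : Tm k} {x x' : ℕ} {τ : STy} {P P' : ATy (k + 1)}
    {ρ' ρ : ℕ → ℕ} (h : SubATy N x τ P P') (c : RenCompat ρ' ρ x x') :
    SubATy (N.rename ρ) x' τ (P.rename ρ') (P'.rename ρ) := by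
  cases h with | fam h =>
  simp only [ATy.rename]; exact .fam (h.rename c)

theorem SubTy.rename {k : ℕ} {N : Tm k} {x x' : ℕ} {τ : STy} {A A' : Ty (k + 1)}
    {ρ' ρ : ℕ → ℕ} (h : SubTy N x τ A A') (c : RenCompat ρ' ρ x x') :
    SubTy (N.rename ρ) x' τ (A.rename ρ') (A'.rename ρ) := by
  induction h generalizing ρ' ρ x' with
  | atom h => simp only [Ty.rename]; exact .atom (h.rename c)
  | pi _ _ ihB ihA =>
    have h := ihA c.lift
    rw [← Tm.rename_weaken_one] at h
    simp only [Ty.rename]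
    exact .pi (ihB c) h

theorem SubKd.rename {k : ℕ} {N : Tm k} {x x' : ℕ} {τ : STy} {K K' : Kd (k + 1)}
    {ρ' ρ : ℕ → ℕ} (h : SubKd N x τ K K') (c : RenCompat ρ' ρ x x') :
    SubKd (N.rename ρ) x' τ (K.rename ρ') (K'.rename ρ) := by
  induction h generalizing ρ' ρ x' with
  | type => simp only [Kd.rename]; exact .type
  | cotype => simp only [Kd.rename]; exact .cotype
  | pi hA _ ih =>
    have h := ih c.lift
    rw [← Tm.rename_weaken_one] at h
    simp only [Kd.rename]
    exact .pi (hA.rename c) h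

theorem SubATy.trunc {k : ℕ} {N : Tm (k + 1)} {x : ℕ} {τ : STy} {P P' : ATy (k + 2)}
    (h : SubATy N x τ P P') : SubATy (k := k) N.trunc x τ P.truncAux P'.truncAux := by
  cases h with | fam h =>
  simp only [ATy.truncAux]; exact .fam h.truncAux

theorem SubTy.trunc : {k : ℕ} → (A : Ty (k + 2)) → {N : Tm (k + 1)} → {x : ℕ} → {τ : STy} →
    {A' : Ty (k + 2)} → SubTy N x τ A A' → SubTy (k := k) N.trunc x τ A.trunc A'.trunc
  | _, .atom P, _, _, _, _, .atom h => by
    simp only [Ty.trunc, Ty.truncAux]; exact .atom h.trunc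
  | _, .pi B A, _, _, _, _, .pi h h' => by
    have h₁ := SubTy.trunc B h
    have h₂ := SubTy.trunc A h'
    rw [Tm.trunc_weaken] at h₂
    simp only [Ty.trunc, Ty.truncAux] at *
    exact .pi h₁ h₂

theorem SubKd.trunc : {k : ℕ} → (K : Kd (k + 2)) → {N : Tm (k + 1)} → {x : ℕ} → {τ : STy} →
    {K' : Kd (k + 2)} → SubKd N x τ K K' → SubKd (k := k) N.trunc x τ K.trunc K'.trunc
  | _, .type, _, _, _, _, .type => by simp only [Kd.trunc, Kd.truncAux]; exact .type
  | _, .cotype, _, _, _, _, .cotype => by simp only [Kd.trunc, Kd.truncAux]; exact .cotype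
  | _, .pi A K, _, _, _, _, .pi h h' => by
    have h₁ := SubTy.trunc A h
    have h₂ := SubKd.trunc K h'
    rw [Tm.trunc_weaken] at h₂
    simp only [Ty.trunc, Kd.trunc, Kd.truncAux] at *
    exact .pi h₁ h₂

theorem SubTy.vacuous : {k : ℕ} → (A : Ty (k + 1)) → (N : Tm k) → (x : ℕ) → (τ : STy) →
    SubTy N x τ (A.rename (insRen x)) A
  | _, .atom (.fam a S), N, x, τ => by
    simp only [Ty.rename, ATy.rename]; exact .atom (.fam (.vacuous S _ _ _))
  | _, .pi B A, N, x, τ => by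
    simp only [Ty.rename, liftRen_insRen]
    exact .pi (SubTy.vacuous B _ _ _) (SubTy.vacuous A _ _ _)

theorem SubKd.vacuous : {k : ℕ} → (K : Kd (k + 1)) → (N : Tm k) → (x : ℕ) → (τ : STy) →
    SubKd N x τ (K.rename (insRen x)) K
  | _, .type, N, x, τ => by simp only [Kd.rename]; exact .type
  | _, .cotype, N, x, τ => by simp only [Kd.rename]; exact .cotype
  | _, .pi A K, N, x, τ => by
    simp only [Kd.rename, liftRen_insRen]
    exact .pi (.vacuous A _ _ _) (SubKd.vacuous K _ _ _)

theorem SATy.exists_sub {k : ℕ} {γ : SCtx} {N : Tm k} {P : ATy (k + 1)} {x : ℕ} {τ : STy}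
    (hN : STm γ N τ) (h : SATy (insCtx x τ γ) P) : ∃ P', SubATy N x τ P P' ∧ SATy γ P' := by
  cases h with | fam h =>
  obtain ⟨S, h₁, h₂⟩ := SSSp.exists_sub hN h
  exact ⟨_, .fam h₁, .fam h₂⟩

theorem STyOk.exists_sub : {k : ℕ} → (A : Ty (k + 1)) → {γ : SCtx} → {N : Tm k} → {x : ℕ} →
    {τ : STy} → STm γ N τ → STyOk (insCtx x τ γ) A → ∃ A', SubTy N x τ A A' ∧ STyOk γ A'
  | _, .atom P, _, _, _, _, hN, .atom h => by
    obtain ⟨P, h₁, h₂⟩ := SATy.exists_sub hN h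
    exact ⟨_, .atom h₁, .atom h₂⟩
  | _, .pi B A, γ, N, x, τ, hN, .pi hB hA => by
    obtain ⟨B', h₁, h₂⟩ := STyOk.exists_sub B hN hB
    rw [insCtx_comm (Nat.zero_le x)] at hA
    obtain ⟨A', h₃, h₄⟩ := STyOk.exists_sub A (hN.weaken_one _) hA
    exact ⟨_, .pi h₁ h₃, .pi h₂ (by rwa [h₁.erase_eq])⟩

theorem SKd.exists_sub : {k : ℕ} → (K : Kd (k + 1)) → {γ : SCtx} → {N : Tm k} → {x : ℕ} →
    {τ : STy} → STm γ N τ → SKd (insCtx x τ γ) K → ∃ K', SubKd N x τ K K' ∧ SKd γ K'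
  | _, .type, _, _, _, _, _, _ => ⟨_, .type, .type⟩
  | _, .cotype, _, _, _, _, _, _ => ⟨_, .cotype, .cotype⟩
  | _, .pi A K, γ, N, x, τ, hN, .pi hA hK => by
    obtain ⟨A', h₁, h₂⟩ := STyOk.exists_sub A hN hA
    rw [insCtx_comm (Nat.zero_le x)] at hK
    obtain ⟨K', h₃, h₄⟩ := SKd.exists_sub K (hN.weaken_one _) hK
    exact ⟨_, .pi h₁ h₃, .pi h₂ (by rwa [h₁.erase_eq])⟩

theorem STyOk.sub {k : ℕ} {γ : SCtx} {N : Tm k} {A A' : Ty (k + 1)} {x : ℕ} {τ : STy}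
    (hN : STm γ N τ) (hA : STyOk (insCtx x τ γ) A) (h : SubTy N x τ A A') : STyOk γ A' := by
  obtain ⟨A₁, h₁, h₂⟩ := STyOk.exists_sub A hN hA
  rwa [h.det h₁]

theorem SKd.sub {k : ℕ} {γ : SCtx} {N : Tm k} {K K' : Kd (k + 1)} {x : ℕ} {τ : STy}
    (hN : STm γ N τ) (hK : SKd (insCtx x τ γ) K) (h : SubKd N x τ K K') : SKd γ K' := by
  obtain ⟨K₁, h₁, h₂⟩ := SKd.exists_sub K hN hK
  rwa [h.det h₁]

theorem SubSSp.cross {τ₁ τ₂ : STy} {k : ℕ} {S S₁ S₂ S₃ : SSp (k + 1)} {γ : SCtx} {x y : ℕ}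
    {N₁ N₁' N₂ : Tm k} (c : Crossing γ x y τ₁ τ₂ N₁ N₁' N₂)
    (h : SSSp (insCtx x τ₁ (insCtx y τ₂ γ)) S)
    (h₁ : SubSSp N₁ x τ₁ S S₁) (h₃ : SubSSp N₂ y τ₂ S₁ S₃)
    (h₂ : SubSSp (N₂.rename (insRen x)) (y + 1) τ₂ S S₂) : SubSSp N₁' x τ₁ S₂ S₃ := by
  have hh := h
  rw [insCtx_comm c.le] at hh
  obtain ⟨S₄, h₄, -⟩ := SSSp.exists_sub c.ty₁' (SSSp.sub c.ty₂' hh h₂)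
  rwa [SubSSp.comm c h h₁ h₃ h₂ h₄]

theorem SubTy.cross {τ₁ τ₂ : STy} : {k : ℕ} → (A : Ty (k + 1)) → {A₁ A₂ A₃ : Ty (k + 1)} →
    {γ : SCtx} → {x y : ℕ} → {N₁ N₁' N₂ : Tm k} → Crossing γ x y τ₁ τ₂ N₁ N₁' N₂ →
    STyOk (insCtx x τ₁ (insCtx y τ₂ γ)) A →
    SubTy N₁ x τ₁ A A₁ → SubTy N₂ y τ₂ A₁ A₃ →
    SubTy (N₂.rename (insRen x)) (y + 1) τ₂ A A₂ → SubTy N₁' x τ₁ A₂ A₃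
  | _, .atom (.fam a S), _, _, _, _, _, _, _, _, _, c, .atom (.fam h), .atom (.fam h₁), h₃,
      .atom (.fam h₂) => by
    cases h₃ with | atom h₃ =>
    cases h₃ with | fam h₃ =>
    exact .atom (.fam (.cross c h h₁ h₃ h₂))
  | _, .pi B A, _, _, _, _, x, y, _, _, _, c, .pi h h', .pi h₁ h₁', h₃, .pi h₂ h₂' => by
    cases h₃ with | pi h₃ h₃' =>
    rw [insCtx_comm (Nat.zero_le x), insCtx_comm (Nat.zero_le y)] at h'
    rw [Tm.rename_insRen_weaken_one] at h₂'
    exact .pi (SubTy.cross B c h h₁ h₃ h₂) (SubTy.cross A (c.lift _) h' h₁' h₃' h₂')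

theorem SubKd.cross {τ₁ τ₂ : STy} : {k : ℕ} → (K : Kd (k + 1)) → {K₁ K₂ K₃ : Kd (k + 1)} →
    {γ : SCtx} → {x y : ℕ} → {N₁ N₁' N₂ : Tm k} → Crossing γ x y τ₁ τ₂ N₁ N₁' N₂ →
    SKd (insCtx x τ₁ (insCtx y τ₂ γ)) K →
    SubKd N₁ x τ₁ K K₁ → SubKd N₂ y τ₂ K₁ K₃ →
    SubKd (N₂.rename (insRen x)) (y + 1) τ₂ K K₂ → SubKd N₁' x τ₁ K₂ K₃
  | _, .type, _, _, _, _, _, _, _, _, _, c, _, .type, h₃, .type => by cases h₃; exact .type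
  | _, .cotype, _, _, _, _, _, _, _, _, _, c, _, .cotype, h₃, .cotype => by
    cases h₃; exact .cotype
  | _, .pi A K, _, _, _, _, x, y, _, _, _, c, .pi h h', .pi h₁ h₁', h₃, .pi h₂ h₂' => by
    cases h₃ with | pi h₃ h₃' =>
    rw [insCtx_comm (Nat.zero_le x), insCtx_comm (Nat.zero_le y)] at h'
    rw [Tm.rename_insRen_weaken_one] at h₂'
    exact .pi (.cross A c h h₁ h₃ h₂) (SubKd.cross K (c.lift _) h' h₁' h₃' h₂')

/-! ### From typing to simple typing -/

/-- The erasure of a context. -/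
def Ctx.sctx {k : ℕ} : Ctx k → SCtx
  | [] => emptySCtx
  | A :: Γ => insCtx 0 A.erase (Ctx.sctx Γ)

theorem Ctx.sctx_trunc {k : ℕ} (Γ : Ctx (k + 2)) : Ctx.sctx (Ctx.trunc Γ) = Ctx.sctx Γ := by
  induction Γ with
  | nil => rfl
  | cons A Γ ih =>
    have e : Ctx.trunc (A :: Γ) = A.trunc :: Ctx.trunc Γ := rfl
    rw [e, Ctx.sctx, Ctx.sctx, ih, Ty.erase_trunc]

theorem Lookup.sctx {k : ℕ} {Γ : Ctx k} {x : ℕ} {A : Ty k} (h : Lookup Γ x A) :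
    Ctx.sctx Γ x = some A.erase := by
  induction h with
  | here => rw [Ctx.sctx, insCtx_self, Ty.erase_weaken]
  | there _ ih => rw [Ctx.sctx, insCtx_zero_succ, ih, Ty.erase_weaken]

theorem STm.of_trunc : {k : ℕ} → {Γ : Ctx (k + 1)} → {M : Tm k} → {B : Ty (k + 1)} →
    STm (Ctx.sctx (Ctx.trunc Γ)) M B.trunc.erase → STm (Ctx.sctx Γ) M B.erase
  | 0, _, _, _, _ => .zero ..
  | _ + 1, _, _, _, h => by rwa [Ctx.sctx_trunc, Ty.erase_trunc] at h

mutual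

theorem TyOk.sTyOk : {k : ℕ} → {Sg : Sig k} → {Γ : Ctx k} → {A : Ty k} →
    (h : TyOk Sg Γ A) → STyOk (Ctx.sctx Γ) A
  | _, _, _, _, .zero .. => .zero ..
  | _, _, _, _, .pi h h' => .pi h.sTyOk h'.sTyOk
  | _, _, _, _, .atom h _ => .atom h.sATy
termination_by structural _ _ _ _ h => h

theorem SynATy.sATy : {k : ℕ} → {Sg : Sig k} → {Γ : Ctx k} → {P : ATy k} → {K : Kd k} →
    (h : SynATy Sg Γ P K) → SATy (Ctx.sctx Γ) P
  | _, _, _, _, _, .zero .. => .zero ..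
  | _, _, _, _, _, .fam _ h => .fam h.sSSp

theorem SpKd.sSSp : {k : ℕ} → {Sg : Sig k} → {Γ : Ctx k} → {S : SSp k} → {K K' : Kd k} →
    (h : SpKd Sg Γ S K K') → SSSp (Ctx.sctx Γ) S
  | _, _, _, _, _, _, .zero .. => .zero ..
  | _, _, _, _, _, _, .nil => .nil
  | _, _, _, _, _, _, .cons h _ h' => .cons h.sTm.of_trunc h'.sSSp
termination_by structural _ _ _ _ _ _ h => h

theorem Chk.sTm : {k : ℕ} → {Sg : Sig k} → {Γ : Ctx k} → {M : Tm k} → {A : Ty k} →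
    (h : Chk Sg Γ M A) → STm (Ctx.sctx Γ) M A.erase
  | _, _, _, _, _, .zero .. => .zero ..
  | _, _, _, _, _, .neu h _ => .neu h.sNe
  | _, _, _, _, _, .lam _ h => .lam h.sTm
termination_by structural _ _ _ _ _ h => h

theorem SynNe.sNe : {k : ℕ} → {Sg : Sig k} → {Γ : Ctx k} → {R : Neu k} → {P : ATy k} →
    (h : SynNe Sg Γ R P) → SNe (Ctx.sctx Γ) R
  | _, _, _, _, _, .zero .. => .zero ..
  | _, _, _, _, _, .var l h => .var l.sctx h.sCSp
  | _, _, _, _, _, .con _ h => .con h.sSSp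
termination_by structural _ _ _ _ _ h => h

theorem CSpTy.sCSp : {k : ℕ} → {Sg : Sig k} → {Γ : Ctx k} → {T : CSp k} → {A : Ty k} →
    {P : ATy k} → (h : CSpTy Sg Γ T A P) → SCSp (Ctx.sctx Γ) T A.erase
  | _, _, _, _, _, _, .zero .. => .zero ..
  | _, _, _, _, _, _, .nil => .nil
  | _, _, _, _, _, _, .cons h s h' => .cons h.sTm (by have := h'.sCSp; rwa [s.erase_eq] at this)
termination_by structural _ _ _ _ _ _ h => h

theorem SSpTy.sSSp : {k : ℕ} → {Sg : Sig k} → {Γ : Ctx k} → {S : SSp k} → {A : Ty k} →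
    {P : ATy k} → (h : SSpTy Sg Γ S A P) → SSSp (Ctx.sctx Γ) S
  | _, _, _, _, _, _, .zero .. => .zero ..
  | _, _, _, _, _, _, .nil => .nil
  | _, _, _, _, _, _, .cons h _ h' => .cons h.sTm.of_trunc h'.sSSp
termination_by structural _ _ _ _ _ _ h => h

end

theorem KdOk.sKd {k : ℕ} {Sg : Sig k} {Γ : Ctx k} {K : Kd k} (h : KdOk Sg Γ K) :
    SKd (Ctx.sctx Γ) K := by
  induction h with
  | zero => exact .zero ..
  | type => exact .type
  | cotype => exact .cotype
  | pi h _ ih => exact .pi h.sTyOk ih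

theorem SigOk.con_sTyOk {k : ℕ} {Sg : Sig k} (h : SigOk Sg) {c : ConName} {A : Ty k}
    (hc : Decl.con c A ∈ Sg) : STyOk emptySCtx A := by
  induction h with
  | zero => exact .zero ..
  | nil => cases hc
  | fam _ _ ih =>
    rcases List.mem_cons.1 hc with e | hc
    · cases e
    · exact ih hc
  | con _ hA ih =>
    rcases List.mem_cons.1 hc with e | hc
    · cases e
      exact hA.sTyOk
    · exact ih hc

theorem SigOk.fam_sKd {k : ℕ} {Sg : Sig k} (h : SigOk Sg) {a : FamName} {K : Kd k}
    (ha : Decl.fam a K ∈ Sg) : SKd emptySCtx K := by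
  induction h with
  | zero => exact .zero ..
  | nil => cases ha
  | con _ _ ih =>
    rcases List.mem_cons.1 ha with e | ha
    · cases e
    · exact ih ha
  | fam _ hK ih =>
    rcases List.mem_cons.1 ha with e | ha
    · cases e
      exact hK.sKd
    · exact ih ha

theorem CtxOk.lookup_sTyOk {k : ℕ} {Sg : Sig k} {Γ : Ctx k} (h : CtxOk Sg Γ) {x : ℕ} {A : Ty k}
    (l : Lookup Γ x A) : STyOk (Ctx.sctx Γ) A := by
  induction l with
  | here =>
    rw [Ty.weaken_eq]
    cases h with
    | zero => exact .zero ..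
    | cons _ hA => exact hA.sTyOk.rename (.insRen _ _ _)
  | there _ ih =>
    rw [Ty.weaken_eq]
    cases h with
    | zero => exact .zero ..
    | cons h _ => exact (ih h).rename (.insRen _ _ _)

theorem CSpTy.sATy : {k : ℕ} → {Sg : Sig (k + 1)} → {Γ : Ctx (k + 1)} → (T : CSp (k + 1)) →
    {A : Ty (k + 1)} → {P : ATy (k + 1)} → CSpTy Sg Γ T A P → STyOk (Ctx.sctx Γ) A →
    SATy (Ctx.sctx Γ) P
  | _, _, _, .nil, _, _, .nil, .atom h => h
  | _, _, _, .cons M T, _, _, .cons hM s hT, .pi _ h =>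
    CSpTy.sATy T hT (.sub hM.sTm.trunc h s)

theorem SSpTy.sATy : {k : ℕ} → {Sg : Sig (k + 1)} → {Γ : Ctx (k + 1)} → (S : SSp (k + 1)) →
    {A : Ty (k + 1)} → {P : ATy (k + 1)} → SSpTy Sg Γ S A P → STyOk (Ctx.sctx Γ) A →
    SATy (Ctx.sctx Γ) P
  | _, _, _, .nil, _, _, .nil, .atom h => h
  | _, _, _, .cons M S, _, _, .cons hM s hS, .pi _ h =>
    SSpTy.sATy S hS (.sub hM.sTm.of_trunc h s)

theorem SynNe.sATy {k : ℕ} {Sg : Sig (k + 1)} {Γ : Ctx (k + 1)} {R : Neu (k + 1)}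
    {P : ATy (k + 1)} (h : SynNe Sg Γ R P) (hSg : SigOk Sg) (hΓ : CtxOk Sg Γ) :
    SATy (Ctx.sctx Γ) P := by
  cases h with
  | var l h => exact CSpTy.sATy _ h (hΓ.lookup_sTyOk l)
  | con l h => exact SSpTy.sATy _ h ((hSg.con_sTyOk l).of_empty _)

theorem Chk.sTyOk : {k : ℕ} → {Sg : Sig (k + 1)} → {Γ : Ctx (k + 1)} → (M : Tm (k + 1)) →
    {A : Ty (k + 1)} → Chk Sg Γ M A → SigOk Sg → CtxOk Sg Γ → STyOk (Ctx.sctx Γ) A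
  | _, _, _, .neu _, _, .neu h e, hSg, hΓ => by
    cases e
    exact .atom (h.sATy hSg hΓ)
  | _, _, _, .lam M, _, .lam hB h, hSg, hΓ =>
    .pi hB.sTyOk (Chk.sTyOk M h hSg (.cons hΓ hB))

/-! ### Renaming in typing derivations -/

/-- The types and kinds in the signature are closed. -/
structure SigClosed {k : ℕ} (Sg : Sig k) : Prop where
  con : ∀ c A, Decl.con c A ∈ Sg → ∀ ρ, A.rename ρ = A
  fam : ∀ a K, Decl.fam a K ∈ Sg → ∀ ρ, K.rename ρ = K

theorem SigOk.closed {k : ℕ} {Sg : Sig k} (h : SigOk Sg) : SigClosed Sg where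
  con _ _ hc := (h.con_sTyOk hc).rename_eq
  fam _ _ ha := (h.fam_sKd ha).rename_eq

theorem SigClosed.trunc {k : ℕ} {Sg : Sig (k + 1)} (h : SigClosed Sg) :
    SigClosed (Sig.trunc Sg) where
  con c A hc ρ := by
    obtain ⟨d, hd, e⟩ := List.mem_map.1 hc
    cases d with
    | fam => simp [Decl.trunc] at e
    | con c' A' =>
      simp only [Decl.trunc, Decl.con.injEq] at e
      rw [← e.2, ← Ty.trunc_rename, h.con _ _ hd]
  fam a K ha ρ := by
    obtain ⟨d, hd, e⟩ := List.mem_map.1 ha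
    cases d with
    | con => simp [Decl.trunc] at e
    | fam a' K' =>
      simp only [Decl.trunc, Decl.fam.injEq] at e
      rw [← e.2, ← Kd.trunc_rename, h.fam _ _ hd]

/-- `ρ` is a renaming from `Γ` to `Γ₁`. -/
def TRen {k : ℕ} (ρ : ℕ → ℕ) (Γ Γ₁ : Ctx k) : Prop :=
  ∀ x A, Lookup Γ x A → Lookup Γ₁ (ρ x) (A.rename ρ)

theorem TRen.lift {k : ℕ} {ρ : ℕ → ℕ} {Γ Γ₁ : Ctx k} (h : TRen ρ Γ Γ₁) (B : Ty k) :
    TRen (liftRen ρ) (B :: Γ) (B.rename ρ :: Γ₁) := by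
  intro x A l
  cases l with
  | here => rw [Ty.rename_weaken]; exact .here
  | there l => rw [Ty.rename_weaken]; exact .there (h _ _ l)

theorem Lookup.trunc {k : ℕ} {Γ : Ctx (k + 1)} {x : ℕ} {A : Ty (k + 1)} (l : Lookup Γ x A) :
    Lookup (Ctx.trunc Γ) x A.trunc := by
  induction l with
  | here => rw [Ty.weaken, Ty.trunc_rename]; exact .here
  | there _ ih => rw [Ty.weaken, Ty.trunc_rename]; exact .there ih

theorem Lookup.of_trunc {k : ℕ} {Γ : Ctx (k + 1)} {x : ℕ} {A : Ty k}
    (l : Lookup (Ctx.trunc Γ) x A) : ∃ B, B.trunc = A ∧ Lookup Γ x B := by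
  induction Γ generalizing x A with
  | nil => cases l
  | cons C Γ ih =>
    cases l with
    | here => exact ⟨_, Ty.trunc_rename .., .here⟩
    | there l =>
      obtain ⟨B, rfl, h⟩ := ih l
      exact ⟨_, Ty.trunc_rename .., .there h⟩

theorem TRen.trunc {k : ℕ} {ρ : ℕ → ℕ} {Γ Γ₁ : Ctx (k + 1)} (h : TRen ρ Γ Γ₁) :
    TRen ρ (Ctx.trunc Γ) (Ctx.trunc Γ₁) := by
  intro x A l
  obtain ⟨B, rfl, l'⟩ := l.of_trunc
  rw [← Ty.trunc_rename]
  exact (h _ _ l').trunc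

mutual

theorem TyOk.rename : {k : ℕ} → {Sg : Sig k} → {Γ : Ctx k} → {A : Ty k} →
    (h : TyOk Sg Γ A) → {ρ : ℕ → ℕ} → {Γ₁ : Ctx k} → SigClosed Sg → TRen ρ Γ Γ₁ →
    TyOk Sg Γ₁ (A.rename ρ)
  | _, _, _, _, .zero .., _, _, _, _ => .zero ..
  | _, _, _, _, .pi h h', _, _, s, r => by
    simp only [Ty.rename]; exact .pi (h.rename s r) (h'.rename s (r.lift _))
  | _, _, _, _, .atom h e, _, _, s, r => by
    have h' := h.rename s r
    simp only [Ty.rename]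
    refine .atom h' ?_
    rcases e with rfl | rfl <;> simp only [Kd.rename] <;> tauto
termination_by structural _ _ _ _ h => h

theorem SynATy.rename : {k : ℕ} → {Sg : Sig k} → {Γ : Ctx k} → {P : ATy k} → {K : Kd k} →
    (h : SynATy Sg Γ P K) → {ρ : ℕ → ℕ} → {Γ₁ : Ctx k} → SigClosed Sg → TRen ρ Γ Γ₁ →
    SynATy Sg Γ₁ (P.rename ρ) (K.rename ρ)
  | _, _, _, _, _, .zero .., _, _, _, _ => .zero ..
  | _, _, _, _, _, .fam ha h, _, _, s, r => by
    have h' := h.rename s r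
    rw [s.fam _ _ ha] at h'
    simp only [ATy.rename]
    exact .fam ha h'
termination_by structural _ _ _ _ _ h => h

theorem SpKd.rename : {k : ℕ} → {Sg : Sig k} → {Γ : Ctx k} → {S : SSp k} → {K K' : Kd k} →
    (h : SpKd Sg Γ S K K') → {ρ : ℕ → ℕ} → {Γ₁ : Ctx k} → SigClosed Sg → TRen ρ Γ Γ₁ →
    SpKd Sg Γ₁ (S.rename ρ) (K.rename ρ) (K'.rename ρ)
  | _, _, _, _, _, _, .zero .., _, _, _, _ => .zero ..
  | _, _, _, _, _, _, .nil, _, _, _, _ => by simp only [SSp.rename]; exact .nil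
  | _, _, _, _, _, _, .cons h t h', ρ, _, s, r => by
    have hM := h.rename s.trunc r.trunc
    rw [← Ty.trunc_rename] at hM
    have hK := t.rename (.zero ρ)
    simp only [SSp.rename, Kd.rename]
    exact .cons hM (by rwa [Ty.erase_rename]) (h'.rename s r)
termination_by structural _ _ _ _ _ _ h => h

theorem Chk.rename : {k : ℕ} → {Sg : Sig k} → {Γ : Ctx k} → {M : Tm k} → {A : Ty k} →
    (h : Chk Sg Γ M A) → {ρ : ℕ → ℕ} → {Γ₁ : Ctx k} → SigClosed Sg → TRen ρ Γ Γ₁ →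
    Chk Sg Γ₁ (M.rename ρ) (A.rename ρ)
  | _, _, _, _, _, .zero .., _, _, _, _ => .zero ..
  | _, _, _, _, _, .neu h e, _, _, s, r => by
    simp only [Tm.rename, Ty.rename]; exact .neu (h.rename s r) (by rw [e])
  | _, _, _, _, _, .lam h h', _, _, s, r => by
    simp only [Tm.rename, Ty.rename]; exact .lam (h.rename s r) (h'.rename s (r.lift _))
termination_by structural _ _ _ _ _ h => h

theorem SynNe.rename : {k : ℕ} → {Sg : Sig k} → {Γ : Ctx k} → {R : Neu k} → {P : ATy k} →
    (h : SynNe Sg Γ R P) → {ρ : ℕ → ℕ} → {Γ₁ : Ctx k} → SigClosed Sg → TRen ρ Γ Γ₁ →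
    SynNe Sg Γ₁ (R.rename ρ) (P.rename ρ)
  | _, _, _, _, _, .zero .., _, _, _, _ => .zero ..
  | _, _, _, _, _, .var l h, _, _, s, r => by
    simp only [Neu.rename]; exact .var (r _ _ l) (h.rename s r)
  | _, _, _, _, _, .con hc h, _, _, s, r => by
    have h' := h.rename s r
    rw [s.con _ _ hc] at h'
    simp only [Neu.rename]
    exact .con hc h'
termination_by structural _ _ _ _ _ h => h

theorem CSpTy.rename : {k : ℕ} → {Sg : Sig k} → {Γ : Ctx k} → {T : CSp k} → {A : Ty k} →
    {P : ATy k} → (h : CSpTy Sg Γ T A P) → {ρ : ℕ → ℕ} → {Γ₁ : Ctx k} → SigClosed Sg →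
    TRen ρ Γ Γ₁ → CSpTy Sg Γ₁ (T.rename ρ) (A.rename ρ) (P.rename ρ)
  | _, _, _, _, _, _, .zero .., _, _, _, _ => .zero ..
  | _, _, _, _, _, _, .nil, _, _, _, _ => by simp only [CSp.rename, Ty.rename]; exact .nil
  | _, _, _, _, _, _, .cons h t h', ρ, _, s, r => by
    have hA := t.rename (.zero ρ)
    rw [← Tm.trunc_rename] at hA
    simp only [CSp.rename, Ty.rename]
    exact .cons (h.rename s r) (by rwa [Ty.erase_rename]) (h'.rename s r)
termination_by structural _ _ _ _ _ _ h => h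

theorem SSpTy.rename : {k : ℕ} → {Sg : Sig k} → {Γ : Ctx k} → {S : SSp k} → {A : Ty k} →
    {P : ATy k} → (h : SSpTy Sg Γ S A P) → {ρ : ℕ → ℕ} → {Γ₁ : Ctx k} → SigClosed Sg →
    TRen ρ Γ Γ₁ → SSpTy Sg Γ₁ (S.rename ρ) (A.rename ρ) (P.rename ρ)
  | _, _, _, _, _, _, .zero .., _, _, _, _ => .zero ..
  | _, _, _, _, _, _, .nil, _, _, _, _ => by simp only [SSp.rename, Ty.rename]; exact .nil
  | _, _, _, _, _, _, .cons h t h', ρ, _, s, r => by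
    have hM := h.rename s.trunc r.trunc
    rw [← Ty.trunc_rename] at hM
    have hA := t.rename (.zero ρ)
    simp only [SSp.rename, Ty.rename]
    exact .cons hM (by rwa [Ty.erase_rename]) (h'.rename s r)
termination_by structural _ _ _ _ _ _ h => h

end

/-! ### Truncation of typing derivations -/

/-- A declaration with the last observation forgotten (the depth `0` is left alone). -/
def Decl.truncAux {k : ℕ} : Decl k → Decl (k - 1)
  | .fam a K => .fam a K.truncAux
  | .con c A => .con c A.truncAux

/-- A signature with the last observation forgotten (the depth `0` is left alone). -/
def Sig.truncAux {k : ℕ} (Sg : Sig k) : Sig (k - 1) := Sg.map Decl.truncAux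

/-- A context with the last observation forgotten (the depth `0` is left alone). -/
def Ctx.truncAux {k : ℕ} (Γ : Ctx k) : Ctx (k - 1) := Γ.map Ty.truncAux

theorem Sig.truncAux_eq {k : ℕ} (Sg : Sig (k + 1)) : Sig.truncAux Sg = Sig.trunc Sg := by
  refine List.map_congr_left fun d _ => ?_
  cases d <;> rfl

mutual

theorem TyOk.truncAux : {k : ℕ} → {Sg : Sig k} → {Γ : Ctx k} → {A : Ty k} →
    (h : TyOk Sg Γ A) → TyOk (Sig.truncAux Sg) (Ctx.truncAux Γ) A.truncAux
  | _, _, _, _, .zero .. => .zero ..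
  | _, _, _, _, .pi (k := 0) h h' => .zero ..
  | _, _, _, _, .pi (k := _ + 1) h h' => by
    simp only [Ty.truncAux]; exact .pi h.truncAux h'.truncAux
  | _, _, _, _, .atom (k := 0) h e => .zero ..
  | _, _, _, _, .atom (k := _ + 1) h e => by
    simp only [Ty.truncAux]
    refine .atom h.truncAux ?_
    rcases e with rfl | rfl <;> simp only [Kd.truncAux] <;> tauto
termination_by structural _ _ _ _ h => h

theorem SynATy.truncAux : {k : ℕ} → {Sg : Sig k} → {Γ : Ctx k} → {P : ATy k} → {K : Kd k} →
    (h : SynATy Sg Γ P K) →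
    SynATy (Sig.truncAux Sg) (Ctx.truncAux Γ) P.truncAux K.truncAux
  | _, _, _, _, _, .zero .. => .zero ..
  | _, _, _, _, _, .fam (k := 0) ha h => .zero ..
  | _, _, _, _, _, .fam (k := _ + 1) ha h => by
    simp only [ATy.truncAux]; exact .fam (List.mem_map.2 ⟨_, ha, rfl⟩) h.truncAux
termination_by structural _ _ _ _ _ h => h

theorem SpKd.truncAux : {k : ℕ} → {Sg : Sig k} → {Γ : Ctx k} → {S : SSp k} → {K K' : Kd k} →
    (h : SpKd Sg Γ S K K') →
    SpKd (Sig.truncAux Sg) (Ctx.truncAux Γ) S.truncAux K.truncAux K'.truncAux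
  | _, _, _, _, _, _, .zero .. => .zero ..
  | _, _, _, _, _, _, .nil (k := 0) => .zero ..
  | _, _, _, _, _, _, .nil (k := _ + 1) => by simp only [SSp.truncAux]; exact .nil
  | _, _, _, _, _, _, .cons (k := 0) h t h' => .zero ..
  | _, _, _, _, _, _, .cons (k := _ + 1) (Sg := Sg) (A := A) h t h' => by
    have hM := h.truncAux
    have hK := SubKd.trunc _ t
    rw [← Ty.erase_trunc] at hK
    rw [Sig.truncAux_eq, ← Sig.truncAux_eq Sg] at hM
    simp only [SSp.truncAux, Kd.truncAux]
    exact .cons hM hK h'.truncAux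
termination_by structural _ _ _ _ _ _ h => h

theorem Chk.truncAux : {k : ℕ} → {Sg : Sig k} → {Γ : Ctx k} → {M : Tm k} → {A : Ty k} →
    (h : Chk Sg Γ M A) → Chk (Sig.truncAux Sg) (Ctx.truncAux Γ) M.truncAux A.truncAux
  | _, _, _, _, _, .zero .. => .zero ..
  | _, _, _, _, _, .neu (k := 0) h e => .zero ..
  | _, _, _, _, _, .neu (k := _ + 1) h e => by
    simp only [Tm.truncAux, Ty.truncAux]; exact .neu h.truncAux (by rw [e])
  | _, _, _, _, _, .lam (k := 0) h h' => .zero ..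
  | _, _, _, _, _, .lam (k := _ + 1) h h' => by
    simp only [Tm.truncAux, Ty.truncAux]; exact .lam h.truncAux h'.truncAux
termination_by structural _ _ _ _ _ h => h

theorem SynNe.truncAux : {k : ℕ} → {Sg : Sig k} → {Γ : Ctx k} → {R : Neu k} → {P : ATy k} →
    (h : SynNe Sg Γ R P) → SynNe (Sig.truncAux Sg) (Ctx.truncAux Γ) R.truncAux P.truncAux
  | _, _, _, _, _, .zero .. => .zero ..
  | _, _, _, _, _, .var (k := 0) l h => .zero ..
  | _, _, _, _, _, .var (k := _ + 1) l h => by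
    simp only [Neu.truncAux]; exact .var l.trunc h.truncAux
  | _, _, _, _, _, .con (k := 0) hc h => .zero ..
  | _, _, _, _, _, .con (k := _ + 1) hc h => by
    simp only [Neu.truncAux]; exact .con (List.mem_map.2 ⟨_, hc, rfl⟩) h.truncAux
termination_by structural _ _ _ _ _ h => h

theorem CSpTy.truncAux : {k : ℕ} → {Sg : Sig k} → {Γ : Ctx k} → {T : CSp k} → {A : Ty k} →
    {P : ATy k} → (h : CSpTy Sg Γ T A P) →
    CSpTy (Sig.truncAux Sg) (Ctx.truncAux Γ) T.truncAux A.truncAux P.truncAux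
  | _, _, _, _, _, _, .zero .. => .zero ..
  | _, _, _, _, _, _, .nil (k := 0) => .zero ..
  | _, _, _, _, _, _, .nil (k := _ + 1) => by
    simp only [CSp.truncAux, Ty.truncAux]; exact .nil
  | _, _, _, _, _, _, .cons (k := 0) h t h' => .zero ..
  | _, _, _, _, _, _, .cons (k := _ + 1) h t h' => by
    have hA := SubTy.trunc _ t
    rw [← Ty.erase_trunc] at hA
    simp only [CSp.truncAux, Ty.truncAux]
    exact .cons h.truncAux hA h'.truncAux
termination_by structural _ _ _ _ _ _ h => h

theorem SSpTy.truncAux : {k : ℕ} → {Sg : Sig k} → {Γ : Ctx k} → {S : SSp k} → {A : Ty k} →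
    {P : ATy k} → (h : SSpTy Sg Γ S A P) →
    SSpTy (Sig.truncAux Sg) (Ctx.truncAux Γ) S.truncAux A.truncAux P.truncAux
  | _, _, _, _, _, _, .zero .. => .zero ..
  | _, _, _, _, _, _, .nil (k := 0) => .zero ..
  | _, _, _, _, _, _, .nil (k := _ + 1) => by
    simp only [SSp.truncAux, Ty.truncAux]; exact .nil
  | _, _, _, _, _, _, .cons (k := 0) h t h' => .zero ..
  | _, _, _, _, _, _, .cons (k := _ + 1) (Sg := Sg) h t h' => by
    have hM := h.truncAux
    have hA := SubTy.trunc _ t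
    rw [← Ty.erase_trunc] at hA
    rw [Sig.truncAux_eq, ← Sig.truncAux_eq Sg] at hM
    simp only [SSp.truncAux, Ty.truncAux]
    exact .cons hM hA h'.truncAux
termination_by structural _ _ _ _ _ _ h => h

end

theorem Chk.trunc {k : ℕ} {Sg : Sig (k + 1)} {Γ : Ctx (k + 1)} {M : Tm (k + 1)}
    {A : Ty (k + 1)} (h : Chk Sg Γ M A) : Chk (Sig.trunc Sg) (Ctx.trunc Γ) M.trunc A.trunc := by
  rw [← Sig.truncAux_eq]; exact h.truncAux

theorem TyOk.trunc {k : ℕ} {Sg : Sig (k + 1)} {Γ : Ctx (k + 1)} {A : Ty (k + 1)}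
    (h : TyOk Sg Γ A) : TyOk (Sig.trunc Sg) (Ctx.trunc Γ) A.trunc := by
  rw [← Sig.truncAux_eq]; exact h.truncAux

theorem KdOk.trunc : {k : ℕ} → {Sg : Sig (k + 1)} → {Γ : Ctx (k + 1)} → (K : Kd (k + 1)) →
    KdOk Sg Γ K → KdOk (Sig.trunc Sg) (Ctx.trunc Γ) K.trunc
  | 0, _, _, _, _ => .zero ..
  | _ + 1, _, _, .type, _ => by simp only [Kd.trunc, Kd.truncAux]; exact .type
  | _ + 1, _, _, .cotype, _ => by simp only [Kd.trunc, Kd.truncAux]; exact .cotype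
  | _ + 1, _, _, .pi A K, .pi h h' => by
    have hA := h.trunc
    have hK := KdOk.trunc K h'
    simp only [Kd.trunc, Kd.truncAux]
    exact .pi hA hK

theorem CtxOk.trunc {k : ℕ} {Sg : Sig (k + 1)} {Γ : Ctx (k + 1)} (h : CtxOk Sg Γ) :
    CtxOk (Sig.trunc Sg) (Ctx.trunc Γ) := by
  cases k with
  | zero => exact .zero ..
  | succ k =>
    induction Γ with
    | nil => exact .nil
    | cons A Γ ih => cases h with | cons h hA => exact .cons (ih h) hA.trunc

theorem SigOk.trunc {k : ℕ} {Sg : Sig (k + 1)} (h : SigOk Sg) : SigOk (Sig.trunc Sg) := by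
  cases k with
  | zero => exact .zero ..
  | succ k =>
    induction Sg with
    | nil => exact .nil
    | cons d Sg ih =>
      cases h with
      | fam h hK => exact .fam (ih h) (KdOk.trunc _ hK)
      | con h hA => exact .con (ih h) hA.trunc

/-! ### The substitution theorem -/

/-- The situation of the substitution `[N/x]` from `Γ, x : A, Γ'` to `Γ, Γ''`. -/
structure Instantiation {k : ℕ} (Sg : Sig (k + 1)) (Γ Γ' Γ'' : Ctx (k + 1)) (N : Tm (k + 1))
    (A : Ty (k + 1)) : Prop where
  sig : SigOk Sg
  ctx : CtxOk Sg (Γ' ++ A :: Γ)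
  chk : Chk Sg Γ N A
  sub : SubCtx N.trunc A.erase Γ' Γ''

theorem SubCtx.length_eq {k : ℕ} {N : Tm k} {τ : STy} {Γ' Γ'' : Ctx (k + 1)}
    (h : SubCtx N τ Γ' Γ'') : Γ''.length = Γ'.length := by
  induction h with
  | nil => rfl
  | cons _ _ ih => simp [ih]

theorem SubCtx.sctx {k : ℕ} {N : Tm k} {Γ Γ' Γ'' : Ctx (k + 1)} {A : Ty (k + 1)}
    (h : SubCtx N A.erase Γ' Γ'') :
    Ctx.sctx (Γ' ++ A :: Γ) = insCtx Γ'.length A.erase (Ctx.sctx (Γ'' ++ Γ)) := by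
  induction h with
  | nil => rfl
  | cons _ t ih =>
    simp only [List.cons_append, Ctx.sctx, ih, List.length_cons, t.erase_eq]
    exact insCtx_comm (Nat.zero_le _) ..

theorem SubCtx.lookup {k : ℕ} {N : Tm k} {Γ Γ' Γ'' : Ctx (k + 1)} {A : Ty (k + 1)}
    (h : SubCtx N A.erase Γ' Γ'') {y : ℕ} {C : Ty (k + 1)} (l : Lookup (Γ' ++ A :: Γ) y C) :
    (y = Γ'.length ∧ C = (A.rename (fun i => i + Γ'.length)).rename (insRen Γ'.length)) ∨
    ∃ z C', y = insRen Γ'.length z ∧ Lookup (Γ'' ++ Γ) z C' ∧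
      SubTy (N.weaken Γ'.length) Γ'.length A.erase C C' := by
  induction h generalizing y C with
  | nil =>
    cases l with
    | here =>
      refine Or.inl ⟨rfl, ?_⟩
      rw [Ty.rename_rename, List.length_nil, insRen_zero]; rfl
    | there l =>
      refine Or.inr ⟨_, _, by rw [List.length_nil, insRen_zero], l, ?_⟩
      rw [Ty.weaken_eq]; exact .vacuous ..
  | @cons Δ Δ' B B' _ t ih =>
    cases l with
    | here =>
      refine Or.inr ⟨0, B'.weaken, rfl, .here, ?_⟩
      rw [List.length_cons, ← Tm.weaken_weaken_one, Tm.weaken_one, Ty.weaken_eq, Ty.weaken_eq]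
      exact t.rename (.insert (Nat.zero_le _))
    | there l =>
      rcases ih l with ⟨rfl, rfl⟩ | ⟨z, C', rfl, l', t'⟩
      · refine Or.inl ⟨rfl, ?_⟩
        rw [← Ty.rename_weaken, liftRen_insRen]
        congr 1
        simp only [Ty.weaken, Ty.rename_rename]; rfl
      · refine Or.inr ⟨z + 1, C'.weaken, ?_, .there l', ?_⟩
        · rw [List.length_cons, ← liftRen_insRen]; rfl
        · rw [List.length_cons, ← Tm.weaken_weaken_one, Tm.weaken_one, Ty.weaken_eq, Ty.weaken_eq]
          exact t'.rename (.insert (Nat.zero_le _))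

theorem SubCtx.trunc {k : ℕ} {N : Tm (k + 1)} {τ : STy} {Γ' Γ'' : Ctx (k + 2)}
    (h : SubCtx N τ Γ' Γ'') : SubCtx N.trunc τ (Ctx.trunc Γ') (Ctx.trunc Γ'') := by
  induction h with
  | nil => exact .nil
  | @cons Δ _ _ _ _ t ih =>
    refine .cons ih ?_
    rw [List.length_map, ← Tm.trunc_weaken]
    exact SubTy.trunc _ t

theorem TRen.append {k : ℕ} (Γ Δ : Ctx k) : TRen (fun i => i + Δ.length) Γ (Δ ++ Γ) := by
  induction Δ with
  | nil =>
    intro x A l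
    have : A.rename (fun i => i + ([] : Ctx k).length) = A := A.rename_id
    rw [this]; exact l
  | cons B Δ ih =>
    intro x A l
    have h := (ih x A l).there (B := B)
    rw [Ty.weaken, Ty.rename_rename] at h
    exact h

namespace Instantiation

variable {k : ℕ} {Sg : Sig (k + 1)} {Γ Γ' Γ'' : Ctx (k + 1)} {N : Tm (k + 1)} {A : Ty (k + 1)}

theorem sctx (s : Instantiation Sg Γ Γ' Γ'' N A) :
    Ctx.sctx (Γ' ++ A :: Γ) = insCtx Γ'.length A.erase (Ctx.sctx (Γ'' ++ Γ)) := s.sub.sctx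

theorem chk_weaken (s : Instantiation Sg Γ Γ' Γ'' N A) :
    Chk Sg (Γ'' ++ Γ) (N.weaken Γ'.length) (A.rename (fun i => i + Γ'.length)) := by
  rw [← s.sub.length_eq]
  exact s.chk.rename s.sig.closed (.append Γ Γ'')

theorem sTm (s : Instantiation Sg Γ Γ' Γ'' N A) :
    STm (Ctx.sctx (Γ'' ++ Γ)) (N.weaken Γ'.length) A.erase := by
  have := s.chk_weaken.sTm
  rwa [Ty.erase_rename] at this

theorem sTm_trunc (s : Instantiation Sg Γ Γ' Γ'' N A) :
    STm (Ctx.sctx (Γ'' ++ Γ)) (N.trunc.weaken Γ'.length) A.erase := by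
  rw [← Tm.trunc_weaken]
  exact s.sTm.trunc

theorem cons (s : Instantiation Sg Γ Γ' Γ'' N A) {B B' : Ty (k + 1)}
    (hB : TyOk Sg (Γ' ++ A :: Γ) B) (t : SubTy (N.trunc.weaken Γ'.length) Γ'.length A.erase B B') :
    Instantiation Sg Γ (B :: Γ') (B' :: Γ'') N A where
  sig := s.sig
  ctx := .cons s.ctx hB
  chk := s.chk
  sub := .cons s.sub t

/-- Substitution in an argument of a dependent type commutes with the instantiation of the type. -/
theorem crossing (s : Instantiation Sg Γ Γ' Γ'' N A) {M M' : Tm k} {τ : STy}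
    (hM : STm (Ctx.sctx (Γ' ++ A :: Γ)) M τ)
    (h : SubTm (N.trunc.weaken Γ'.length) Γ'.length A.erase M M') :
    Crossing (Ctx.sctx (Γ'' ++ Γ)) 0 Γ'.length τ A.erase M M' (N.trunc.weaken Γ'.length) where
  le := Nat.zero_le _
  ty₁ := by rw [← s.sctx]; exact hM
  ty₂ := s.sTm_trunc
  sub := h

end Instantiation

theorem Instantiation.trunc {k : ℕ} {Sg : Sig (k + 2)} {Γ Γ' Γ'' : Ctx (k + 2)} {N : Tm (k + 2)}
    {A : Ty (k + 2)} (s : Instantiation Sg Γ Γ' Γ'' N A) :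
    Instantiation (Sig.trunc Sg) (Ctx.trunc Γ) (Ctx.trunc Γ') (Ctx.trunc Γ'') N.trunc A.trunc where
  sig := s.sig.trunc
  ctx := by
    have h := s.ctx.trunc
    simpa only [Ctx.trunc, List.map_append, List.map_cons] using h
  chk := s.chk.trunc
  sub := by rw [Ty.erase_trunc]; exact s.sub.trunc

/-- Substitution in terms of depth `k + 1` preserves typing. -/
def ChkSubst (k : ℕ) : Prop :=
  ∀ {Sg : Sig (k + 1)} {Γ Γ' Γ'' : Ctx (k + 1)} {N M M' : Tm (k + 1)} {A B B' : Ty (k + 1)},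
    Instantiation Sg Γ Γ' Γ'' N A → Chk Sg (Γ' ++ A :: Γ) M B →
    SubTm (N.weaken Γ'.length) Γ'.length A.erase M M' →
    SubTy (N.trunc.weaken Γ'.length) Γ'.length A.erase B B' → Chk Sg (Γ'' ++ Γ) M' B'

/-- Substitution in the arguments of suspended spines of depth `k + 1` preserves typing. -/
def ArgSubst (k : ℕ) : Prop :=
  ∀ {Sg : Sig (k + 1)} {Γ Γ' Γ'' : Ctx (k + 1)} {N : Tm (k + 1)} {M M' : Tm k}
    {A B B' : Ty (k + 1)},
    Instantiation Sg Γ Γ' Γ'' N A →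
    Chk (Sig.trunc Sg) (Ctx.trunc (Γ' ++ A :: Γ)) M B.trunc →
    SubTm (N.trunc.weaken Γ'.length) Γ'.length A.erase M M' →
    SubTy (N.trunc.weaken Γ'.length) Γ'.length A.erase B B' →
    Chk (Sig.trunc Sg) (Ctx.trunc (Γ'' ++ Γ)) M' B'.trunc

theorem argSubst_zero : ArgSubst 0 := fun _ _ _ _ => .zero ..

theorem ChkSubst.argSubst_succ {k : ℕ} (H : ChkSubst k) : ArgSubst (k + 1) := by
  intro Sg Γ Γ' Γ'' N M M' A B B' s hM t t'
  have e : (Ctx.trunc Γ').length = Γ'.length := by simp [Ctx.trunc]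
  have h := SubTy.trunc _ t'
  rw [Tm.trunc_weaken, ← Ty.erase_trunc A, ← e] at h
  rw [← Ty.erase_trunc A, ← e] at t
  simp only [Ctx.trunc, List.map_append, List.map_cons] at hM ⊢
  exact H s.trunc hM t h

section

variable {k : ℕ} {Sg : Sig (k + 1)} {Γ : Ctx (k + 1)} {N : Tm (k + 1)} {A : Ty (k + 1)}

theorem SSpTy.subst (H : ArgSubst k) {Γ' Γ'' : Ctx (k + 1)}
    (s : Instantiation Sg Γ Γ' Γ'' N A) :
    (S : SSp (k + 1)) → {S' : SSp (k + 1)} → {B B' : Ty (k + 1)} → {P P' : ATy (k + 1)} →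
    SSpTy Sg (Γ' ++ A :: Γ) S B P → STyOk (Ctx.sctx (Γ' ++ A :: Γ)) B →
    SubSSp (N.trunc.weaken Γ'.length) Γ'.length A.erase S S' →
    SubTy (N.trunc.weaken Γ'.length) Γ'.length A.erase B B' →
    SubATy (N.trunc.weaken Γ'.length) Γ'.length A.erase P P' → SSpTy Sg (Γ'' ++ Γ) S' B' P'
  | .nil, _, _, _, _, _, .nil, _, .nil, .atom t, u => by
    rw [t.det u]; exact .nil
  | .cons M S, _, _, _, _, _, .cons hM v hS, .pi hB hC, .cons tM tS, .pi tB tC, u => by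
    have hM' := hM.sTm.of_trunc
    have hC' := STyOk.sub hM' hC v
    have hC'' := hC'
    rw [s.sctx] at hC'' hC
    obtain ⟨C₃, tC₃, -⟩ := STyOk.exists_sub _ s.sTm_trunc hC''
    rw [Tm.weaken_one] at tC
    have c := SubTy.cross _ (s.crossing hM' tM) hC v tC₃ tC
    rw [← tB.erase_eq] at c
    exact .cons (H s hM tM tB) c (SSpTy.subst H s S hS hC' tS tC₃ u)

theorem SpKd.subst (H : ArgSubst k) {Γ' Γ'' : Ctx (k + 1)}
    (s : Instantiation Sg Γ Γ' Γ'' N A) :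
    (S : SSp (k + 1)) → {S' : SSp (k + 1)} → {K K' L L' : Kd (k + 1)} →
    SpKd Sg (Γ' ++ A :: Γ) S K L → SKd (Ctx.sctx (Γ' ++ A :: Γ)) K →
    SubSSp (N.trunc.weaken Γ'.length) Γ'.length A.erase S S' →
    SubKd (N.trunc.weaken Γ'.length) Γ'.length A.erase K K' →
    SubKd (N.trunc.weaken Γ'.length) Γ'.length A.erase L L' → SpKd Sg (Γ'' ++ Γ) S' K' L'
  | .nil, _, _, _, _, _, .nil, _, .nil, t, u => by
    rw [t.det u]; exact .nil
  | .cons M S, _, _, _, _, _, .cons hM v hS, .pi hB hC, .cons tM tS, .pi tB tC, u => by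
    have hM' := hM.sTm.of_trunc
    have hC' := SKd.sub hM' hC v
    have hC'' := hC'
    rw [s.sctx] at hC'' hC
    obtain ⟨C₃, tC₃, -⟩ := SKd.exists_sub _ s.sTm_trunc hC''
    rw [Tm.weaken_one] at tC
    have c := SubKd.cross _ (s.crossing hM' tM) hC v tC₃ tC
    rw [← tB.erase_eq] at c
    exact .cons (H s hM tM tB) c (SpKd.subst H s S hS hC' tS tC₃ u)

theorem SigOk.sub_fam (h : SigOk Sg) {a : FamName} {K : Kd (k + 1)} (ha : Decl.fam a K ∈ Sg)
    (M : Tm k) (x : ℕ) (τ : STy) : SubKd M x τ K K := by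
  have := SubKd.vacuous K M x τ
  rwa [h.closed.fam _ _ ha] at this

theorem SigOk.sub_con (h : SigOk Sg) {c : ConName} {B : Ty (k + 1)} (hc : Decl.con c B ∈ Sg)
    (M : Tm k) (x : ℕ) (τ : STy) : SubTy M x τ B B := by
  have := SubTy.vacuous B M x τ
  rwa [h.closed.con _ _ hc] at this

theorem TyOk.subst (H : ArgSubst k) :
    (B : Ty (k + 1)) → {B' : Ty (k + 1)} → {Γ' Γ'' : Ctx (k + 1)} →
    Instantiation Sg Γ Γ' Γ'' N A → TyOk Sg (Γ' ++ A :: Γ) B →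
    SubTy (N.trunc.weaken Γ'.length) Γ'.length A.erase B B' → TyOk Sg (Γ'' ++ Γ) B'
  | .pi B C, _, _, _, s, .pi hB hC, .pi tB tC => by
    rw [Tm.weaken_weaken_one] at tC
    exact .pi (TyOk.subst H B s hB tB) (TyOk.subst H C (s.cons hB tB) hC tC)
  | .atom (.fam a S), _, _, _, s, .atom (.fam ha hS) e, .atom (.fam t) => by
    refine .atom (.fam ha (hS.subst H s S ((s.sig.fam_sKd ha).of_empty _) t
      (s.sig.sub_fam ha _ _ _) ?_)) e
    rcases e with rfl | rfl
    · exact .type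
    · exact .cotype

theorem Instantiation.ctxOk (H : ArgSubst k) {Γ' Γ'' : Ctx (k + 1)}
    (s : Instantiation Sg Γ Γ' Γ'' N A) : CtxOk Sg (Γ'' ++ Γ) := by
  obtain ⟨hSg, hΓ, hN, t⟩ := s
  induction t with
  | nil => cases hΓ with | cons h _ => exact h
  | cons t tB ih =>
    cases hΓ with
    | cons h hB => exact .cons (ih h) (TyOk.subst H _ ⟨hSg, h, hN, t⟩ hB tB)

end

/-- Spine application at the simple type `τ` preserves typing at depth `k + 1`. -/
def AppTyped (k : ℕ) (τ : STy) : Prop :=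
  ∀ {Sg : Sig (k + 1)} {Δ : Ctx (k + 1)} {N : Tm (k + 1)} {A : Ty (k + 1)} {T : CSp (k + 1)}
    {R : Neu (k + 1)} {P : ATy (k + 1)}, A.erase = τ → SigOk Sg → CtxOk Sg Δ →
    Chk Sg Δ N A → CSpTy Sg Δ T A P → AppCSp T τ N R → SynNe Sg Δ R P

mutual

theorem Chk.subst {k : ℕ} {Sg : Sig (k + 1)} {Γ : Ctx (k + 1)} {N : Tm (k + 1)}
    {A : Ty (k + 1)} (H : ArgSubst k) (Ha : AppTyped k A.erase) :
    (M : Tm (k + 1)) → {M' : Tm (k + 1)} → {B B' : Ty (k + 1)} → {Γ' Γ'' : Ctx (k + 1)} →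
    Instantiation Sg Γ Γ' Γ'' N A → Chk Sg (Γ' ++ A :: Γ) M B →
    SubTm (N.weaken Γ'.length) Γ'.length A.erase M M' →
    SubTy (N.trunc.weaken Γ'.length) Γ'.length A.erase B B' → Chk Sg (Γ'' ++ Γ) M' B'
  | .lam M, _, _, _, _, _, s, .lam hB h, .lam t, .pi tB tC => by
    rw [Tm.weaken_weaken_one] at t tC
    exact .lam (TyOk.subst H _ s hB tB) (Chk.subst H Ha M (s.cons hB tB) h t tC)
  | .neu R, _, _, _, _, _, s, .neu h e, .neu t, .atom u => by
    subst e
    exact .neu (SynNe.subst H Ha R s h t u) rfl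

theorem SynNe.subst {k : ℕ} {Sg : Sig (k + 1)} {Γ : Ctx (k + 1)} {N : Tm (k + 1)}
    {A : Ty (k + 1)} (H : ArgSubst k) (Ha : AppTyped k A.erase) :
    (R : Neu (k + 1)) → {R' : Neu (k + 1)} → {P P' : ATy (k + 1)} → {Γ' Γ'' : Ctx (k + 1)} →
    Instantiation Sg Γ Γ' Γ'' N A → SynNe Sg (Γ' ++ A :: Γ) R P →
    SubNe (N.weaken Γ'.length) Γ'.length A.erase R R' →
    SubATy (N.trunc.weaken Γ'.length) Γ'.length A.erase P P' → SynNe Sg (Γ'' ++ Γ) R' P'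
  | .var y T, R', P, P', Γ', Γ'', s, .var l h, t, u => by
    have hC := s.ctx.lookup_sTyOk l
    rcases s.sub.lookup l with ⟨rfl, rfl⟩ | ⟨z, C', rfl, l', v⟩
    · obtain ⟨T', tT, a⟩ := t.inv_var
      have hT := CSpTy.subst H Ha T s h hC tT (.vacuous ..) u
      exact Ha (Ty.erase_rename ..) s.sig (s.ctxOk H) s.chk_weaken hT a
    · obtain ⟨T', tT, rfl⟩ := t.inv_var_ins
      exact .var l' (CSpTy.subst H Ha T s h hC tT v u)
  | .con c S, _, _, _, _, _, s, .con hc h, .con t, u => by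
    rw [Tm.trunc_weaken] at t
    exact .con hc (h.subst H s S ((s.sig.con_sTyOk hc).of_empty _) t (s.sig.sub_con hc _ _ _) u)

theorem CSpTy.subst {k : ℕ} {Sg : Sig (k + 1)} {Γ : Ctx (k + 1)} {N : Tm (k + 1)}
    {A : Ty (k + 1)} (H : ArgSubst k) (Ha : AppTyped k A.erase) :
    (T : CSp (k + 1)) → {T' : CSp (k + 1)} → {B B' : Ty (k + 1)} → {P P' : ATy (k + 1)} →
    {Γ' Γ'' : Ctx (k + 1)} → Instantiation Sg Γ Γ' Γ'' N A →
    CSpTy Sg (Γ' ++ A :: Γ) T B P → STyOk (Ctx.sctx (Γ' ++ A :: Γ)) B →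
    SubCSp (N.weaken Γ'.length) Γ'.length A.erase T T' →
    SubTy (N.trunc.weaken Γ'.length) Γ'.length A.erase B B' →
    SubATy (N.trunc.weaken Γ'.length) Γ'.length A.erase P P' → CSpTy Sg (Γ'' ++ Γ) T' B' P'
  | .nil, _, _, _, _, _, _, _, s, .nil, _, .nil, .atom t, u => by
    rw [t.det u]; exact .nil
  | .cons M T, _, _, _, _, _, _, _, s, .cons hM v hT, .pi hB hC, .cons tM tT, .pi tB tC, u => by
    have hM' := hM.sTm.trunc
    have tM' := tM.trunc
    rw [Tm.trunc_weaken] at tM'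
    have hC' := STyOk.sub hM' hC v
    have hC'' := hC'
    rw [s.sctx] at hC'' hC
    obtain ⟨C₃, tC₃, -⟩ := STyOk.exists_sub _ s.sTm_trunc hC''
    rw [Tm.weaken_one] at tC
    have c := SubTy.cross _ (s.crossing hM' tM') hC v tC₃ tC
    rw [← tB.erase_eq] at c
    exact .cons (Chk.subst H Ha M s hM tM tB) c (CSpTy.subst H Ha T s hT hC' tT tC₃ u)

end

theorem appTyped {k : ℕ} (H : ArgSubst k) (τ : STy) : AppTyped k τ := by
  induction τ with
  | base =>
    intro Sg Δ N A T R P _ _ _ hN hT ha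
    cases ha with | nil =>
    cases hT with | nil =>
    cases hN with | neu h e => exact e ▸ h
  | arrow a b iha ihb =>
    intro Sg Δ N A T R P e hSg hΔ hN hT ha
    cases ha with | cons t ha =>
    cases hT with | cons hN₀ v hT =>
    cases hN with | lam hB hM =>
    simp only [Ty.erase, STy.arrow.injEq] at e
    obtain ⟨rfl, rfl⟩ := e
    have s : Instantiation Sg Δ [] [] _ _ := ⟨hSg, .cons hΔ hB, hN₀, .nil⟩
    have hM' := Chk.subst H iha _ s hM (by rw [List.length_nil, Tm.weaken_zero]; exact t)
      (by rw [List.length_nil, Tm.weaken_zero]; exact v)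
    exact ihb v.erase_eq hSg hΔ hM' hT ha

theorem argSubst (k : ℕ) : ArgSubst k := by
  induction k with
  | zero => exact argSubst_zero
  | succ k ih =>
    exact ChkSubst.argSubst_succ fun s h t u => Chk.subst ih (appTyped ih _) _ s h t u

theorem SubCtx.exists {k : ℕ} {Sg : Sig (k + 1)} {Γ : Ctx (k + 1)} {N : Tm (k + 1)}
    {A : Ty (k + 1)} (hSg : SigOk Sg) (hN : Chk Sg Γ N A) :
    (Γ' : Ctx (k + 1)) → CtxOk Sg (Γ' ++ A :: Γ) → ∃ Γ'', SubCtx N.trunc A.erase Γ' Γ''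
  | [], _ => ⟨_, .nil⟩
  | B :: Γ', .cons h hB => by
    obtain ⟨Γ'', t⟩ := SubCtx.exists hSg hN Γ' h
    have s : Instantiation Sg Γ Γ' Γ'' N A := ⟨hSg, h, hN, t⟩
    have hB' : STyOk (Ctx.sctx (Γ' ++ A :: Γ)) B := hB.sTyOk
    rw [s.sctx] at hB'
    obtain ⟨B', u, -⟩ := STyOk.exists_sub _ s.sTm_trunc hB'
    exact ⟨_, .cons t u⟩

end CoLF

theorem mainTheorem2 (k : ℕ) (Sg : CoLF.Sig (k + 1)) (Γ Γ' : CoLF.Ctx (k + 1))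
    (N : CoLF.Tm (k + 1)) (A : CoLF.Ty (k + 1)) (hN : CoLF.HasType Sg Γ N A) :
    (∀ (M : CoLF.Tm (k + 1)) (B : CoLF.Ty (k + 1)),
      CoLF.HasType Sg (Γ' ++ A :: Γ) M B →
      ∃ (Γ'' : CoLF.Ctx (k + 1)) (M' : CoLF.Tm (k + 1)) (B' : CoLF.Ty (k + 1)),
        CoLF.SubCtx N.trunc A.erase Γ' Γ'' ∧
        CoLF.SubTm (N.weaken Γ'.length) Γ'.length A.erase M M' ∧
        CoLF.SubTy (N.trunc.weaken Γ'.length) Γ'.length A.erase B B' ∧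
        CoLF.HasType Sg (Γ'' ++ Γ) M' B') ∧
    (∀ B : CoLF.Ty (k + 1),
      CoLF.IsType Sg (Γ' ++ A :: Γ) B →
      ∃ (Γ'' : CoLF.Ctx (k + 1)) (B' : CoLF.Ty (k + 1)),
        CoLF.SubCtx N.trunc A.erase Γ' Γ'' ∧
        CoLF.SubTy (N.trunc.weaken Γ'.length) Γ'.length A.erase B B' ∧
        CoLF.IsType Sg (Γ'' ++ Γ) B') := by
  constructor
  · rintro M B ⟨hSg, hΓ, hM⟩
    obtain ⟨Γ'', t⟩ := CoLF.SubCtx.exists hSg hN.chk Γ' hΓ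
    have s : CoLF.Instantiation Sg Γ Γ' Γ'' N A := ⟨hSg, hΓ, hN.chk, t⟩
    have hM' := hM.sTm
    have hB' := CoLF.Chk.sTyOk _ hM hSg hΓ
    rw [s.sctx] at hM' hB'
    obtain ⟨M', u, -⟩ := s.sTm.exists_sub hM'
    obtain ⟨B', v, -⟩ := CoLF.STyOk.exists_sub _ s.sTm_trunc hB'
    exact ⟨Γ'', M', B', t, u, v, hSg, s.ctxOk (CoLF.argSubst k),
      CoLF.Chk.subst (CoLF.argSubst k) (CoLF.appTyped (CoLF.argSubst k) _) _ s hM u v⟩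
  · rintro B ⟨hSg, hΓ, hB⟩
    obtain ⟨Γ'', t⟩ := CoLF.SubCtx.exists hSg hN.chk Γ' hΓ
    have s : CoLF.Instantiation Sg Γ Γ' Γ'' N A := ⟨hSg, hΓ, hN.chk, t⟩
    have hB' := hB.sTyOk
    rw [s.sctx] at hB'
    obtain ⟨B', v, -⟩ := CoLF.STyOk.exists_sub _ s.sTm_trunc hB'
    exact ⟨Γ'', B', t, v, hSg, s.ctxOk (CoLF.argSubst k), CoLF.TyOk.subst (CoLF.argSubst k) _ s hB v⟩
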